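/- Let $g(0)=1$, $g(1)=2$, $g(n+2)=g(n)+g(n+1)$. A Wang tile is a tuple $t=(t_w,t_e,t_s,t_n)\in H^2\times V^2$ with $H,V$ finite, and a Wang set is a set $\mathcal{T}\subseteq H^2\times V^2$; it is viewed as a transducer with states $H$, a tile $t$ being a transition from $t_w$ to $t_e$ that reads $t_s$ and writes $t_n$. For bi-infinite words $v,v'\in V^{\mathbb{Z}}$ write $v\,\mathcal{T}\,v'$ if $\mathcal{T}$ has a bi-infinite run reading $v$ and writing $v'$. A tiling by $\mathcal{T}$ is a map $f:\mathbb{Z}^2\to\mathcal{T}$ such that the east color of $f(x,y)$ is the west color of $f(x+1,y)$ and the north color of $f(x,y)$ is the south color of $f(x,y+1)$, for all $(x,y)$; it is periodic if it is invariant under translation by some nonzero vector of $\mathbb{Z}^2$. A Wang set is aperiodic if it has a tiling and none of its tilings is periodic. The union of transducers is taken with disjoint sets of states. For $n\ge 0$ let $T_n$ be the following transducer over the alphabet $\{0,1\}$, where an edge labelled $u|u'$ (with $|u|=|u'|$) is a path of $|u|$ transitions through new inner states, reading $u$ and writing $u'$. It has two main states $A,F$ (which coincide if $n=0$). If $n$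 is even it has one edge from $A$ to $F$ labelled $0^{g(n+2)-3}\,|\,1^{g(n+2)-3}$ and five edges from $F$ to $A$ labelled $$\begin{array}{l@{\;|\;}l} 0^{g(n+1)+3}&100\,1^{g(n+1)}\\ 0^{g(n+3)+3}&1^{g(n+2)}\,000\,1^{g(n+1)}\\ 0^{g(n+1)}\,111\,0^{g(n+2)}&1^{g(n+3)+3}\\ 0^{g(n+1)}\,110&1^{g(n+1)+3}\\ 0^{g(n+3)}\,110\,0^{g(n+1)}&1^{g(n+1)}\,100\,1^{g(n+3)} \end{array}$$ If $n$ is odd it has one edge from $A$ to $F$ labelled $1^{g(n+2)-3}\,|\,0^{g(n+2)-3}$ and five edges from $F$ to $A$ labelled $$\begin{array}{l@{\;|\;}l} 1^{g(n+1)+3}&110\,0^{g(n+1)}\\ 1^{g(n+3)+3}&0^{g(n+2)}\,111\,0^{g(n+1)}\\ 1^{g(n+1)}\,000\,1^{g(n+2)}&0^{g(n+3)+3}\\ 1^{g(n+1)}\,100&0^{g(n+1)+3}\\ 1^{g(n+3)}\,100\,1^{g(n+1)}&0^{g(n+1)}\,110\,0^{g(n+3)} \end{array}$$ Theorem. Let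 $n\ge 0$, let $s:\mathbb{Z}\to\{n,n+1,n+2\}$, and let $(w_i)_{i\in\mathbb{Z}}$ be bi-infinite words over $\{0,1\}$ with $w_i\,T_{s(i)}\,w_{i+1}$ for all $i\in\mathbb{Z}$. Then this infinite composition can be rewritten as a composition of $T_{n+1},T_{n+2},T_{n+3}$ by replacing every block $T_{n+1}\circ T_n\circ T_{n+1}$ by $T_{n+3}$. That is, there are $c:\mathbb{Z}\to\mathbb{Z}$ and $s':\mathbb{Z}\to\{n+1,n+2,n+3\}$ such that: - for every $j$, either $c(j+1)=c(j)+1$ and $s'(j)=s(c(j))$, or $c(j+1)=c(j)+3$, $s'(j)=n+3$ and $(s(c(j)),s(c(j)+1),s(c(j)+2))=(n+1,n,n+1)$; - for every $i$ with $(s(i),s(i+1),s(i+2))=(n+1,n,n+1)$ there is $j$ with $c(j)=i$ and $c(j+1)=i+3$; - $w_{c(j)}\,T_{s'(j)}\,w_{c(j+1)}$ for every $j\in\mathbb{Z}$. In particular no $T_n$ remains. Consequently no tiling by $T_0\cup T_1\cup T_2$ is periodic, and the Wang set $T_0\cup T_1\cup T_2$ is aperiodic. -/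

import Mathlib

/-- A Wang tile with horizontal colors (west, east) in `H` and vertical colors (south, north)
in `V`. -/
structure Tile (H V : Type) where
  w : H
  e : H
  s : V
  n : V

/-- A Wang set with vertical colors `V`, also viewed as a transducer: `State` is the finite set of
horizontal colors (the states), `V` is the input and output alphabet, and a tile `t` is a
transition from `t.w` to `t.e` that reads `t.s` and writes `t.n`. -/
structure WangSet (V : Type) where
  State : Type
  finite_state : Finite State
  finite_color : Finite V
  tiles : Set (Tile State V)

namespace WangSet

/-- `f` is a tiling of the plane `ℤ²` by the Wang set `A`. -/
def IsTiling {V : Type} (A : WangSet V) (f : ℤ → ℤ → Tile A.State V) : Prop :=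
  (∀ x y, f x y ∈ A.tiles) ∧
  (∀ x y, (f x y).e = (f (x + 1) y).w) ∧
  (∀ x y, (f x y).n = (f x (y + 1)).s)

/-- The tiling `f` has a nonzero period. -/
def IsPeriodicTiling {V : Type} {A : WangSet V} (f : ℤ → ℤ → Tile A.State V) : Prop :=
  ∃ u v : ℤ, (u, v) ≠ (0, 0) ∧ ∀ x y, f x y = f (x + u) (y + v)

/-- `A` tiles the plane, and no tiling of the plane by `A` is periodic. -/
def IsAperiodic {V : Type} (A : WangSet V) : Prop :=
  (∃ f : ℤ → ℤ → Tile A.State V, A.IsTiling f) ∧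
  ∀ f : ℤ → ℤ → Tile A.State V, A.IsTiling f → ¬ IsPeriodicTiling f

/-- `A.Rel w w'`: the transducer `A` has a bi-infinite run (a tiling of one row) that reads the
bi-infinite word `w` and writes the bi-infinite word `w'`. -/
def Rel {V : Type} (A : WangSet V) (w w' : ℤ → V) : Prop :=
  ∃ f : ℤ → Tile A.State V,
    (∀ x, f x ∈ A.tiles) ∧
    (∀ x, (f x).e = (f (x + 1)).w) ∧
    (∀ x, (f x).s = w x) ∧
    (∀ x, (f x).n = w' x)

/-- The union of two Wang sets (transducers), with states made disjoint. -/
def union {V : Type} (A B : WangSet V) : WangSet V where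
  State := A.State ⊕ B.State
  finite_state :=
    haveI := A.finite_state
    haveI := B.finite_state
    inferInstance
  finite_color := A.finite_color
  tiles :=
    {t | ∃ a ∈ A.tiles, t = ⟨Sum.inl a.w, Sum.inl a.e, a.s, a.n⟩} ∪
    {t | ∃ b ∈ B.tiles, t = ⟨Sum.inr b.w, Sum.inr b.e, b.s, b.n⟩}

end WangSet

/-- States of the transducer drawn in compact form with two main states, one long transition
(the trunk) of length `a` from the first to the second, and long transitions (the petals) of
lengths `l k` from the second to the first. The states `Sum.inl i` lie along the trunk: `i = 0` is
the first main state and `i = a` is the second one (they coincide if `a = 0`, the trunk being then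
labelled by the empty words). The states `Sum.inr ⟨k, j⟩` are the inner states of the petals. -/
abbrev CompactState {K : Type} (a : ℕ) (l : K → ℕ) : Type :=
  Fin (a + 1) ⊕ (Σ k : K, Fin (l k - 1))

/-- The state reached after `j` letters of the petal `k`. -/
def petalNode {K : Type} {a : ℕ} {l : K → ℕ} (k : K) (j : ℕ) : CompactState a l :=
  if j = 0 then Sum.inl (Fin.last a)
  else if h : j - 1 < l k - 1 then Sum.inr ⟨k, ⟨j - 1, h⟩⟩
  else Sum.inl 0

/-- The transducer given in compact form by the label of its trunk and those of its petals; a label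
is the list of the pairs (letter read, letter written). -/
def compactTransducer {V K : Type} [Finite V] [Finite K]
    (trunk : List (V × V)) (petal : K → List (V × V)) : WangSet V where
  State := CompactState trunk.length (fun k => (petal k).length)
  finite_state := inferInstance
  finite_color := inferInstance
  tiles :=
    {t | ∃ i : Fin trunk.length,
      t = ⟨Sum.inl i.castSucc, Sum.inl i.succ, (trunk.get i).1, (trunk.get i).2⟩} ∪
    {t | ∃ (k : K) (j : Fin (petal k).length),
      t = ⟨petalNode k j, petalNode k (j + 1), ((petal k).get j).1, ((petal k).get j).2⟩}

/-- Fibonacci numbers `1, 2, 3, 5, 8, …`. -/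
def fibG : ℕ → ℕ
  | 0 => 1
  | 1 => 2
  | n + 2 => fibG n + fibG (n + 1)

/-- The word `c^k`. -/
abbrev rep (c : Fin 2) (k : ℕ) : List (Fin 2) := List.replicate k c

/-- The word read along the trunk of `T_n`. -/
def trunkIn (n : ℕ) : List (Fin 2) :=
  if Even n then rep 0 (fibG (n + 2) - 3) else rep 1 (fibG (n + 2) - 3)

/-- The word written along the trunk of `T_n`. -/
def trunkOut (n : ℕ) : List (Fin 2) :=
  if Even n then rep 1 (fibG (n + 2) - 3) else rep 0 (fibG (n + 2) - 3)

/-- The words read along the five petals of `T_n`. -/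
def petalIn (n : ℕ) : Fin 5 → List (Fin 2) :=
  if Even n then
    ![rep 0 (fibG (n + 1) + 3),
      rep 0 (fibG (n + 3) + 3),
      rep 0 (fibG (n + 1)) ++ [1, 1, 1] ++ rep 0 (fibG (n + 2)),
      rep 0 (fibG (n + 1)) ++ [1, 1, 0],
      rep 0 (fibG (n + 3)) ++ [1, 1, 0] ++ rep 0 (fibG (n + 1))]
  else
    ![rep 1 (fibG (n + 1) + 3),
      rep 1 (fibG (n + 3) + 3),
      rep 1 (fibG (n + 1)) ++ [0, 0, 0] ++ rep 1 (fibG (n + 2)),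
      rep 1 (fibG (n + 1)) ++ [1, 0, 0],
      rep 1 (fibG (n + 3)) ++ [1, 0, 0] ++ rep 1 (fibG (n + 1))]

/-- The words written along the five petals of `T_n`. -/
def petalOut (n : ℕ) : Fin 5 → List (Fin 2) :=
  if Even n then
    ![[1, 0, 0] ++ rep 1 (fibG (n + 1)),
      rep 1 (fibG (n + 2)) ++ [0, 0, 0] ++ rep 1 (fibG (n + 1)),
      rep 1 (fibG (n + 3) + 3),
      rep 1 (fibG (n + 1) + 3),
      rep 1 (fibG (n + 1)) ++ [1, 0, 0] ++ rep 1 (fibG (n + 3))]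
  else
    ![[1, 1, 0] ++ rep 0 (fibG (n + 1)),
      rep 0 (fibG (n + 2)) ++ [1, 1, 1] ++ rep 0 (fibG (n + 1)),
      rep 0 (fibG (n + 3) + 3),
      rep 0 (fibG (n + 1) + 3),
      rep 0 (fibG (n + 1)) ++ [1, 1, 0] ++ rep 0 (fibG (n + 3))]

/-- Input and output labels have equal lengths, so zipping them below loses nothing. -/
theorem label_length (n : ℕ) :
    (trunkIn n).length = (trunkOut n).length ∧
    ∀ k, (petalIn n k).length = (petalOut n k).length := by
  have h : fibG (n + 3) = fibG (n + 1) + fibG (n + 2) := rfl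
  by_cases hn : Even n
  · refine ⟨by simp [trunkIn, trunkOut, hn], fun k => ?_⟩
    fin_cases k <;> simp [petalIn, petalOut, hn] <;> omega
  · refine ⟨by simp [trunkIn, trunkOut, hn], fun k => ?_⟩
    fin_cases k <;> simp [petalIn, petalOut, hn] <;> omega

/-- The transducer `T_n`. -/
def transT (n : ℕ) : WangSet (Fin 2) :=
  compactTransducer ((trunkIn n).zip (trunkOut n))
    (fun k : Fin 5 => (petalIn n k).zip (petalOut n k))

/-- `IsStacking s w`: the sequence `w` of rows is an infinite composition of the transducers
`T_{s i}`, that is `w_i T_{s i} w_{i+1}` for every `i ∈ ℤ`. -/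
def IsStacking (s : ℤ → ℕ) (w : ℤ → ℤ → Fin 2) : Prop :=
  ∀ i, (transT (s i)).Rel (w i) (w (i + 1))

/-- `T_{n+1} ∘ T_n ∘ T_{n+1}` occurs in the sequence `s` at the indices `i`, `i + 1`, `i + 2`. -/
def BlockAt (n : ℕ) (s : ℤ → ℕ) (i : ℤ) : Prop :=
  s i = n + 1 ∧ s (i + 1) = n ∧ s (i + 2) = n + 1

/-- `s'` is obtained from `s` by replacing every block `T_{n+1} ∘ T_n ∘ T_{n+1}` by `T_{n+3}` and
keeping all the other transducers: the `j`-th transducer of `s'` stands for those of `s` with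
indices `c j, …, c (j + 1) - 1`. -/
def IsBlockReplacement (n : ℕ) (s : ℤ → ℕ) (c : ℤ → ℤ) (s' : ℤ → ℕ) : Prop :=
  (∀ j, (c (j + 1) = c j + 1 ∧ s' j = s (c j)) ∨
        (c (j + 1) = c j + 3 ∧ s' j = n + 3 ∧ BlockAt n s (c j))) ∧
  ∀ i, BlockAt n s i → ∃ j, c j = i ∧ c (j + 1) = i + 3

/-! Put `b = fibG (n + 2)` and `c = fibG (n + 3)`. A run of `T_n` is a cutting of ℤ into cycles
(trunk, then petal) of kinds 0 to 4 and lengths c, b+c, b+c, c, 2c. Its words carry only marks, the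
ends of three-letter blocks: short (110 or 100) or long (111 or 000). Marks are far apart, so a word
determines them. Stacking rows thus means that the marks written by one parse are those read by the
next; the letters and the parity of n disappear.

In `T_{n+1} ∘ T_n ∘ T_{n+1}` every cycle of the middle row leaves a trace, through a mark, in a
neighbouring row. As c/b lies between 8/5 and 5/3, comparing positions of traces excludes kind 4
from all three rows (`middle_no_4`, `first_no_4`, `last_no_4`) and leaves few successions in the
middle row. Cutting that row inside each factor 1 2 leaves only the words 2 3 1, 2 0 2 3 1, 2 0 1 3
1, 2 0 1 and 2 0 2 1 3 1. With the cycles that they force in the outer rows, these are the five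
cycles of `T_{n+3}`, so the composition equals `T_{n+3}` (`transT_rel_comp`, `transT_rel_split`).
One `T_{n+1}` cannot be the last row of a block and the first row of another (`Sandwich.no_chain`).

A word on a background of zeros is never one on a background of ones (`Spaced.lo_ne_hi`), so
consecutive indices have opposite parities. Hence each `T_n` lies between two `T_{n+1}`, the blocks
are disjoint, and all can be replaced. Some `T_n` does occur: otherwise `T_{n+1}` and `T_{n+2}`
would alternate, which `no_chain` forbids one level up.

A non-horizontal period makes the sequence of indices periodic, and each replacement shortens that
period: infinite descent. A horizontal period survives all replacements, while the spacing of marks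
outgrows it. Tilings exist by compactness, since every `T_m` has a run and expands into about m/2
rows or more of `T_0 ∪ T_1 ∪ T_2`. -/

/-! ### Parses of a row into cycles, and their marks -/

/-- The length of the `k`-th cycle (trunk followed by a petal) in terms of two lengths `b`, `c`. -/
def cyc (b c : ℤ) : Fin 5 → ℤ := ![c, b + c, b + c, c, 2 * c]

theorem cyc_0 (b c : ℤ) : cyc b c 0 = c := rfl
theorem cyc_1 (b c : ℤ) : cyc b c 1 = b + c := rfl
theorem cyc_2 (b c : ℤ) : cyc b c 2 = b + c := rfl
theorem cyc_3 (b c : ℤ) : cyc b c 3 = c := rfl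
theorem cyc_4 (b c : ℤ) : cyc b c 4 = 2 * c := rfl

theorem le_cyc {b c : ℤ} (hb : 0 < b) (hc : 0 < c) (k : Fin 5) : c ≤ cyc b c k := by
  fin_cases k <;> simp [cyc] <;> omega

/-- `S x k` means that a cycle of kind `k` starts at `x`; the cycles cover `ℤ` without overlap. -/
structure IsParse (b c : ℤ) (S : ℤ → Fin 5 → Prop) : Prop where
  hb : 0 < b
  hc : 0 < c
  cover : ∀ z, ∃ x k, S x k ∧ x ≤ z ∧ z < x + cyc b c k
  sep : ∀ x k y j, S x k → S y j → x ≤ y → y < x + cyc b c k → x = y ∧ k = j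

/-- Positions of the short marks read by a parse. -/
def inS (b c : ℤ) (S : ℤ → Fin 5 → Prop) (y : ℤ) : Prop := S (y - c) 3 ∨ S (y - (b + c)) 4
/-- Positions of the long marks read by a parse. -/
def inL (c : ℤ) (S : ℤ → Fin 5 → Prop) (y : ℤ) : Prop := S (y - c) 2
/-- Positions of the short marks written by a parse. -/
def outS (b c : ℤ) (S : ℤ → Fin 5 → Prop) (y : ℤ) : Prop := S (y - b) 0 ∨ S (y - c) 4
/-- Positions of the long marks written by a parse. -/
def outL (b : ℤ) (S : ℤ → Fin 5 → Prop) (y : ℤ) : Prop := S (y - 2 * b) 1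

theorem start_at {S : ℤ → Fin 5 → Prop} {x y : ℤ} {k : Fin 5} (h : S x k)
    (e : x = y := by omega) : S y k := e ▸ h

namespace IsParse

variable {b c : ℤ} {S : ℤ → Fin 5 → Prop} {x y : ℤ} {k j : Fin 5}

theorem le_len (hS : IsParse b c S) (k : Fin 5) : c ≤ cyc b c k := le_cyc hS.hb hS.hc k

theorem next (hS : IsParse b c S) (h : S x k) : ∃ j, S (x + cyc b c k) j := by
  have hc := hS.hc
  obtain ⟨y, j, hj, h1, h2⟩ := hS.cover (x + cyc b c k)
  rcases lt_trichotomy y x with hy | hy | hy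
  · have := hS.le_len k
    have := (hS.sep y j x k hj h (by omega) (by omega)).1
    omega
  · subst hy
    have := hS.le_len j
    have := (hS.sep y j y k hj h (by omega) (by omega)).2
    subst this; omega
  · rcases lt_or_eq_of_le h1 with h3 | h3
    · have := (hS.sep x k y j h hj (by omega) (by omega)).1
      omega
    · exact ⟨j, h3 ▸ hj⟩

theorem prev (hS : IsParse b c S) (h : S y j) : ∃ x k, S x k ∧ x + cyc b c k = y := by
  have hc := hS.hc
  obtain ⟨x, k, hk, h1, h2⟩ := hS.cover (y - 1)
  refine ⟨x, k, hk, ?_⟩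
  by_contra hne
  have := (hS.sep x k y j hk h (by omega) (by omega)).1
  omega

/-- The starts of cycles that follow a cycle are its end, or are later by at least `c`. -/
theorem near (hS : IsParse b c S) (h1 : S x k) (h2 : S y j) (hxy : x < y)
    (hy : y < x + cyc b c k + c) : y = x + cyc b c k := by
  obtain ⟨i, hi⟩ := hS.next h1
  have := hS.le_len i
  have := hS.hc
  rcases lt_trichotomy y (x + cyc b c k) with h | h | h
  · have := (hS.sep _ _ _ _ h1 h2 hxy.le h).1
    omega
  · exact h
  · have := (hS.sep _ _ _ _ hi h2 h.le (by omega)).1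
    omega

theorem kind_unique (hS : IsParse b c S) (h1 : S x k) (h2 : S x j) : k = j :=
  (hS.sep x k x j h1 h2 le_rfl (by have := hS.le_len k; have := hS.hc; omega)).2

/-- Two cycles whose positions are incompatible. -/
theorem bad (hS : IsParse b c S) (h1 : S x k) (h2 : S y j)
    (h : (x < y ∧ y < x + cyc b c k + c ∧ y ≠ x + cyc b c k) ∨
      (y < x ∧ x < y + cyc b c j + c ∧ x ≠ y + cyc b c j) := by
        simp only [cyc_0, cyc_1, cyc_2, cyc_3, cyc_4]; omega) : False := by
  rcases h with ⟨h3, h4, h5⟩ | ⟨h3, h4, h5⟩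
  · exact h5 (hS.near h1 h2 h3 h4)
  · exact h5 (hS.near h2 h1 h3 h4)

/-- Two cycles of different kinds at the same position. -/
theorem bad_kind (hS : IsParse b c S) (h1 : S x k) (h2 : S y j) (h : x = y := by omega)
    (hk : k ≠ j := by decide) : False := by
  subst h
  exact hk (hS.kind_unique h1 h2)

theorem next_kind (hS : IsParse b c S) (h : S x k) :
    S (x + cyc b c k) 0 ∨ S (x + cyc b c k) 1 ∨ S (x + cyc b c k) 2 ∨ S (x + cyc b c k) 3 ∨
      S (x + cyc b c k) 4 := by
  obtain ⟨j, hj⟩ := hS.next h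
  fin_cases j <;> simp_all

theorem next_at (hS : IsParse b c S) (h : S x k)
    (e : y = x + cyc b c k := by simp only [cyc_0, cyc_1, cyc_2, cyc_3, cyc_4] <;> omega) :
    S y 0 ∨ S y 1 ∨ S y 2 ∨ S y 3 ∨ S y 4 := by
  subst e
  exact hS.next_kind h

theorem prev_kind (hS : IsParse b c S) (h : S y j) :
    S (y - c) 0 ∨ S (y - (b + c)) 1 ∨ S (y - (b + c)) 2 ∨ S (y - c) 3 ∨ S (y - 2 * c) 4 := by
  obtain ⟨x, k, hk, rfl⟩ := hS.prev h
  fin_cases k <;> simp_all [cyc]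

end IsParse

/-- A parse can be given by the set of its boundaries. -/
theorem IsParse.of_boundary {b c : ℤ} (hb : 0 < b) (hc : 0 < c) {S : ℤ → Fin 5 → Prop}
    {B : ℤ → Prop} (start : ∀ x k, S x k → B x) (kind : ∀ x, B x → ∃ k, S x k)
    (finish : ∀ x k, S x k → B (x + cyc b c k)) (unique : ∀ x k j, S x k → S x j → k = j)
    (between : ∀ x k y, S x k → B y → x < y → x + cyc b c k ≤ y)
    (below : ∀ z, ∃ x, x ≤ z ∧ B x) : IsParse b c S := by
  refine ⟨hb, hc, fun z => ?_, fun x k y j h1 h2 h3 h4 => ?_⟩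
  · obtain ⟨x₀, hx₀, hB₀⟩ := below z
    obtain ⟨x, ⟨hx, hBx⟩, hmax⟩ := Int.exists_greatest_of_bdd (P := fun x => x ≤ z ∧ B x)
      ⟨z, fun x h => h.1⟩ ⟨x₀, hx₀, hB₀⟩
    obtain ⟨k, hk⟩ := kind x hBx
    refine ⟨x, k, hk, hx, ?_⟩
    by_contra hz
    have := hmax _ ⟨by omega, finish x k hk⟩
    have := le_cyc hb hc k
    omega
  · rcases h3.lt_or_eq with h | h
    · have := between x k y h1 (start _ _ h2) h
      omega
    · subst h
      exact ⟨rfl, unique _ _ _ h1 h2⟩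

/-! ### Three stacked rows: which cycles can follow one another -/

/-- The marks written by the parse `S` are those read by the parse `S'`. -/
structure Interface (b c : ℤ) (S : ℤ → Fin 5 → Prop) (b' c' : ℤ) (S' : ℤ → Fin 5 → Prop) :
    Prop where
  short : ∀ y, outS b c S y ↔ inS b' c' S' y
  long : ∀ y, outL b S y ↔ inL c' S' y

/-- Parses `U`, `T`, `V` of three consecutive rows, with middle lengths `b < c`. -/
structure Sandwich (b c : ℤ) (U T V : ℤ → Fin 5 → Prop) : Prop where
  lower : 8 * b ≤ 5 * c
  upper : 3 * c ≤ 5 * b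
  hU : IsParse c (b + c) U
  hT : IsParse b c T
  hV : IsParse c (b + c) V
  hUT : Interface c (b + c) U b c T
  hTV : Interface b c T c (b + c) V

namespace Sandwich

variable {b c : ℤ} {U T V : ℤ → Fin 5 → Prop} {x y z : ℤ}

/-- These inequalities confine c/b to [8/5, 5/3]; all incompatibilities of positions below follow
from them by linear arithmetic. -/
theorem bounds (s : Sandwich b c U T V) : 0 < b ∧ 8 * b ≤ 5 * c ∧ 3 * c ≤ 5 * b :=
  ⟨s.hT.hb, s.lower, s.upper⟩

/-- This and the next ten lemmas follow one mark across an interface; the shift is the difference of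
its offsets in the two cycles. Kinds 2, 3, 4 of `T` are seen from `U`, kinds 0, 1, 4 from `V`. -/
theorem t2 (s : Sandwich b c U T V) (h : T x 2) : U (x - c) 1 :=
  start_at ((s.hUT.long (x + c)).2 (start_at h))

theorem u1 (s : Sandwich b c U T V) (h : U x 1) : T (x + c) 2 :=
  start_at ((s.hUT.long (x + 2 * c)).1 (start_at h))

theorem u0 (s : Sandwich b c U T V) (h : U x 0) : T x 3 ∨ T (x - b) 4 :=
  ((s.hUT.short (x + c)).1 (.inl (start_at h))).imp (start_at ·) (start_at ·)

theorem u4 (s : Sandwich b c U T V) (h : U x 4) : T (x + b) 3 ∨ T x 4 :=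
  ((s.hUT.short (x + b + c)).1 (.inr (start_at h))).imp (start_at ·) (start_at ·)

theorem t3 (s : Sandwich b c U T V) (h : T x 3) : U x 0 ∨ U (x - b) 4 :=
  ((s.hUT.short (x + c)).2 (.inl (start_at h))).imp (start_at ·) (start_at ·)

theorem t4_left (s : Sandwich b c U T V) (h : T x 4) : U (x + b) 0 ∨ U x 4 :=
  ((s.hUT.short (x + b + c)).2 (.inr (start_at h))).imp (start_at ·) (start_at ·)

theorem t1 (s : Sandwich b c U T V) (h : T x 1) : V (x + b - c) 2 :=
  start_at ((s.hTV.long (x + 2 * b)).1 (start_at h))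

theorem v2 (s : Sandwich b c U T V) (h : V x 2) : T (x + c - b) 1 :=
  start_at ((s.hTV.long (x + b + c)).2 (start_at h))

theorem t0 (s : Sandwich b c U T V) (h : T x 0) : V (x - c) 3 ∨ V (x - 2 * c) 4 :=
  ((s.hTV.short (x + b)).1 (.inl (start_at h))).imp (start_at ·) (start_at ·)

theorem t4_right (s : Sandwich b c U T V) (h : T x 4) : V (x - b) 3 ∨ V (x - b - c) 4 :=
  ((s.hTV.short (x + c)).1 (.inr (start_at h))).imp (start_at ·) (start_at ·)

theorem v3 (s : Sandwich b c U T V) (h : V x 3) : T (x + c) 0 ∨ T (x + b) 4 :=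
  ((s.hTV.short (x + b + c)).2 (.inl (start_at h))).imp (start_at ·) (start_at ·)

theorem v4 (s : Sandwich b c U T V) (h : V x 4) : T (x + 2 * c) 0 ∨ T (x + b + c) 4 :=
  ((s.hTV.short (x + b + 2 * c)).2 (.inr (start_at h))).imp (start_at ·) (start_at ·)

/-- In the simple exclusions both cycles have traces in the same outer row, and no parse contains
both traces. Up to shifts of the rows, a half-turn exchanges `U` with `V`, kind 0 with 3 and kind 1
with 2, and fixes kind 4; so the exclusions come in mirror pairs, such as `no_00` and `no_33`,
`no_10` and `no_32`. -/
theorem no_00 (s : Sandwich b c U T V) (h : T x 0) (h' : T (x + c) 0) : False := by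
  have := s.bounds
  rcases s.t0 h with h1 | h1 <;> rcases s.t0 h' with h2 | h2 <;>
    first | exact s.hV.bad h1 h2 | exact s.hV.bad_kind h1 h2

theorem no_10 (s : Sandwich b c U T V) (h : T x 1) (h' : T (x + b + c) 0) : False := by
  have := s.bounds
  have h1 := s.t1 h
  rcases s.t0 h' with h2 | h2 <;> first | exact s.hV.bad h1 h2 | exact s.hV.bad_kind h1 h2

theorem no_11 (s : Sandwich b c U T V) (h : T x 1) (h' : T (x + b + c) 1) : False := by
  have := s.bounds
  exact s.hV.bad (s.t1 h) (s.t1 h')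

theorem no_33 (s : Sandwich b c U T V) (h : T x 3) (h' : T (x + c) 3) : False := by
  have := s.bounds
  rcases s.t3 h with h1 | h1 <;> rcases s.t3 h' with h2 | h2 <;>
    exact s.hU.bad h1 h2

theorem no_32 (s : Sandwich b c U T V) (h : T x 3) (h' : T (x + c) 2) : False := by
  have := s.bounds
  have h2 := s.t2 h'
  rcases s.t3 h with h1 | h1 <;> first | exact s.hU.bad h1 h2 | exact s.hU.bad_kind h1 h2

theorem no_22 (s : Sandwich b c U T V) (h : T x 2) (h' : T (x + b + c) 2) : False := by
  have := s.bounds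
  exact s.hU.bad (s.t2 h) (s.t2 h')

theorem no_44 (s : Sandwich b c U T V) (h : T x 4) (h' : T (x + 2 * c) 4) : False := by
  have := s.bounds
  rcases s.t4_left h with h1 | h1 <;> rcases s.t4_left h' with h2 | h2 <;>
    exact s.hU.bad h1 h2

theorem no_04 (s : Sandwich b c U T V) (h : T x 0) (h' : T (x + c) 4) : False := by
  have := s.bounds
  rcases s.t0 h with h1 | h1 <;> rcases s.t4_right h' with h2 | h2 <;>
    exact s.hV.bad h1 h2

theorem no_14 (s : Sandwich b c U T V) (h : T x 1) (h' : T (x + b + c) 4) : False := by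
  have := s.bounds
  have h1 := s.t1 h
  rcases s.t4_right h' with h2 | h2 <;> exact s.hV.bad h1 h2

theorem no_43 (s : Sandwich b c U T V) (h : T x 4) (h' : T (x + 2 * c) 3) : False := by
  have := s.bounds
  rcases s.t4_left h with h1 | h1 <;> rcases s.t3 h' with h2 | h2 <;>
    exact s.hU.bad h1 h2

theorem no_42 (s : Sandwich b c U T V) (h : T x 4) (h' : T (x + 2 * c) 2) : False := by
  have := s.bounds
  have h2 := s.t2 h'
  rcases s.t4_left h with h1 | h1 <;> exact s.hU.bad h1 h2

/-- A cycle of kind `0` is not followed by one of kind `3`. -/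
theorem no_03 (s : Sandwich b c U T V) (h : T x 0) (h' : T (x + c) 3) : False := by
  have := s.bounds
  -- The 0 has no trace in `U`. Its predecessor can only be a 2, 3 or 4, which has one, incompatible
  -- with that of the 3.
  rcases s.hT.prev_kind h with hp | hp | hp | hp | hp
  · exact s.no_00 hp (start_at h)
  · exact s.no_10 hp (start_at h)
  · have h1 := s.t2 hp
    rcases s.t3 h' with h2 | h2 <;> exact s.hU.bad h1 h2
  · rcases s.t3 hp with h1 | h1 <;> rcases s.t3 h' with h2 | h2 <;> exact s.hU.bad h1 h2
  · rcases s.t4_left hp with h1 | h1 <;> rcases s.t3 h' with h2 | h2 <;> exact s.hU.bad h1 h2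

/-- A cycle of kind `3` is not followed by one of kind `0`. -/
theorem no_30 (s : Sandwich b c U T V) (h : T x 3) (h' : T (x + c) 0) : False := by
  have := s.bounds
  -- The neighbours are forced: the factor must be 2 3 0 1, and this is then refuted in `U`.
  rcases s.hT.next_at h' (y := x + 2 * c) with hn | hn | hn | hn | hn
  · exact s.no_00 h' (start_at hn)
  · have k2 := s.t1 hn
    rcases s.hT.prev_kind h with hp | hp | hp | hp | hp
    · exact s.no_03 hp (start_at h)
    · have k0 := s.t1 hp
      rcases s.t0 h' with k1 | k1 <;> exact s.hV.bad k0 k1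
    · have l0 := s.t2 hp
      -- The 2 forces the 3 to come from `U x 0`. The next cycle of `U` writes no mark, since a
      -- cycle of `T` reading it would clash with the 0 or the 1; so its kind is 2 or 3, and it
      -- conflicts with the trace of whatever follows the 1.
      have l2 : ∃ l, (l = x + b + c) ∧ (U l 2 ∨ U l 3) := by
        refine ⟨_, rfl, ?_⟩
        have l1 : U x 0 := by
          rcases s.t3 h with l1 | l1
          · exact l1
          · exact (s.hU.bad l0 l1).elim
        rcases s.hU.next_at l1 (y := x + b + c) with l2 | l2 | l2 | l2 | l2
        · rcases s.u0 l2 with m | m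
          · exact (s.hT.bad h' m).elim
          · exact (s.hT.bad_kind h' m).elim
        · exact (s.hT.bad hn (s.u1 l2)).elim
        · exact .inl l2
        · exact .inr l2
        · rcases s.u4 l2 with m | m
          · exact (s.hT.bad hn m).elim
          · exact (s.hT.bad h' m).elim
      obtain ⟨l, rfl, l2⟩ := l2
      rcases s.hT.next_at hn (y := x + b + 3 * c) with m | m | m | m | m
      · exact s.no_10 hn (start_at m)
      · exact s.no_11 hn (start_at m)
      · have l3 := s.t2 m
        rcases l2 with l2 | l2 <;> exact s.hU.bad l2 l3
      · rcases l2 with l2 | l2 <;> rcases s.t3 m with l3 | l3 <;> exact s.hU.bad l2 l3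
      · exact s.no_14 hn (start_at m)
    · exact s.no_33 hp (start_at h)
    · exact s.no_43 hp (start_at h)
  · have k2 := s.t2 hn
    rcases s.t3 h with k1 | k1 <;> exact s.hU.bad k1 k2
  · exact s.no_03 h' (start_at hn)
  · exact s.no_04 h' (start_at hn)

/-- The 0 must be followed by 1 or 2, and such a 1 by 2 or 3. The trace in `U` of that 2 or 3
conflicts with the cycle that feeds the 4, or with the successor of that cycle. -/
theorem no_40 (s : Sandwich b c U T V) (h : T x 4) (h' : T (x + 2 * c) 0) : False := by
  have := s.bounds
  have key : U x 4 ∨ U (x + b) 0 ∧ (U (x + 2 * b + c) 2 ∨ U (x + 2 * b + c) 3) := by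
    rcases s.t4_left h with l | l
    · refine .inr ⟨l, ?_⟩
      rcases s.hU.next_at l (y := x + 2 * b + c) with k | k | k | k | k
      · rcases s.u0 k with m | m <;> exact (s.hT.bad h' m).elim
      · exact (s.hT.bad h' (s.u1 k)).elim
      · exact .inl k
      · exact .inr k
      · rcases s.u4 k with m | m <;> exact (s.hT.bad h' m).elim
    · exact .inl l
  rcases s.hT.next_at h' (y := x + 3 * c) with hn | hn | hn | hn | hn
  · exact s.no_00 h' (start_at hn)
  · rcases s.hT.next_at hn (y := x + b + 4 * c) with m | m | m | m | m
    · exact s.no_10 hn (start_at m)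
    · exact s.no_11 hn (start_at m)
    · have := s.t2 m
      rcases key with k | ⟨-, k | k⟩ <;> exact s.hU.bad k this
    · rcases key with k | ⟨-, k | k⟩ <;> rcases s.t3 m with l | l <;> exact s.hU.bad k l
    · exact s.no_14 hn (start_at m)
  · have := s.t2 hn
    rcases key with k | ⟨k, -⟩ <;> exact s.hU.bad k this
  · exact s.no_03 h' (start_at hn)
  · exact s.no_04 h' (start_at hn)

/-- The half-turn of `no_40`, argued in `V`. -/
theorem no_34 (s : Sandwich b c U T V) (h : T (x - c) 3) (h' : T x 4) : False := by
  have := s.bounds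
  have key : V (x - b - c) 4 ∨ V (x - b) 3 ∧ (V (x - 2 * b - c) 0 ∨ V (x - 2 * b - 2 * c) 1) := by
    rcases s.t4_right h' with l | l
    · refine .inr ⟨l, ?_⟩
      rcases s.hV.prev_kind l with k | k | k | k | k
      · exact .inl (start_at k)
      · exact .inr (start_at k)
      · exact (s.hT.bad h (s.v2 k)).elim
      · rcases s.v3 k with m | m <;> exact (s.hT.bad h m).elim
      · rcases s.v4 k with m | m <;> exact (s.hT.bad h m).elim
    · exact .inl l
  rcases s.hT.prev_kind h with hn | hn | hn | hn | hn
  · exact s.no_03 hn (start_at h)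
  · have := s.t1 hn
    rcases key with k | ⟨k, -⟩ <;> exact s.hV.bad k this
  · rcases s.hT.prev_kind hn with m | m | m | m | m
    · rcases key with k | ⟨-, k | k⟩ <;> rcases s.t0 m with l | l <;> exact s.hV.bad k l
    · have := s.t1 m
      rcases key with k | ⟨-, k | k⟩ <;> exact s.hV.bad k this
    · exact s.no_22 m (start_at hn)
    · exact s.no_32 m (start_at hn)
    · exact s.no_42 m (start_at hn)
  · exact s.no_33 hn (start_at h)
  · exact s.no_43 hn (start_at h)

/-- A 4 can only occur in 2 4 1. The 2 then forces its mark to come from `U x 4`, and that long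
cycle conflicts with the trace of the 2 or 3 after the 1. -/
theorem middle_no_4 (s : Sandwich b c U T V) : ¬ T x 4 := by
  intro h
  have := s.bounds
  rcases s.hT.prev_kind h with hp | hp | hp | hp | hp
  · exact s.no_04 hp (start_at h)
  · exact s.no_14 hp (start_at h)
  · have k0 := s.t2 hp
    rcases s.t4_left h with k1 | k1
    · exact s.hU.bad k0 k1
    rcases s.hT.next_at h (y := x + 2 * c) with hn | hn | hn | hn | hn
    · exact s.no_40 h hn
    · rcases s.hT.next_at hn (y := x + b + 3 * c) with m | m | m | m | m
      · exact s.no_10 hn (start_at m)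
      · exact s.no_11 hn (start_at m)
      · exact s.hU.bad k1 (s.t2 m)
      · rcases s.t3 m with l | l <;> exact s.hU.bad k1 l
      · exact s.no_14 hn (start_at m)
    · exact s.no_42 h hn
    · exact s.no_43 h hn
    · exact s.no_44 h hn
  · exact s.no_34 hp h
  · exact s.no_44 hp (start_at h)

theorem after_0 (s : Sandwich b c U T V) (h : T x 0) : T (x + c) 1 ∨ T (x + c) 2 := by
  rcases s.hT.next_kind h with hn | hn | hn | hn | hn
  · exact (s.no_00 h hn).elim
  · exact .inl hn
  · exact .inr hn
  · exact (s.no_03 h hn).elim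
  · exact (s.no_04 h hn).elim

theorem after_1 (s : Sandwich b c U T V) (h : T x 1) : T (x + b + c) 2 ∨ T (x + b + c) 3 := by
  rcases s.hT.next_at h (y := x + b + c) with hn | hn | hn | hn | hn
  · exact (s.no_10 h hn).elim
  · exact (s.no_11 h hn).elim
  · exact .inl hn
  · exact .inr hn
  · exact (s.no_14 h hn).elim

theorem after_2 (s : Sandwich b c U T V) (h : T x 2) :
    T (x + b + c) 0 ∨ T (x + b + c) 1 ∨ T (x + b + c) 3 := by
  rcases s.hT.next_at h (y := x + b + c) with hn | hn | hn | hn | hn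
  · exact .inl hn
  · exact .inr (.inl hn)
  · exact (s.no_22 h hn).elim
  · exact .inr (.inr hn)
  · exact (s.middle_no_4 hn).elim

theorem after_3 (s : Sandwich b c U T V) (h : T x 3) : T (x + c) 1 := by
  rcases s.hT.next_kind h with hn | hn | hn | hn | hn
  · exact (s.no_30 h hn).elim
  · exact hn
  · exact (s.no_32 h hn).elim
  · exact (s.no_33 h hn).elim
  · exact (s.middle_no_4 hn).elim

theorem before_0 (s : Sandwich b c U T V) (h : T x 0) : T (x - b - c) 2 := by
  rcases s.hT.prev_kind h with hp | hp | hp | hp | hp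
  · exact (s.no_00 hp (start_at h)).elim
  · exact (s.no_10 hp (start_at h)).elim
  · exact start_at hp
  · exact (s.no_30 hp (start_at h)).elim
  · exact (s.middle_no_4 hp).elim

theorem before_1 (s : Sandwich b c U T V) (h : T x 1) :
    T (x - c) 0 ∨ T (x - b - c) 2 ∨ T (x - c) 3 := by
  rcases s.hT.prev_kind h with hp | hp | hp | hp | hp
  · exact .inl hp
  · exact (s.no_11 hp (start_at h)).elim
  · exact .inr (.inl (start_at hp))
  · exact .inr (.inr hp)
  · exact (s.middle_no_4 hp).elim

theorem before_2 (s : Sandwich b c U T V) (h : T x 2) : T (x - c) 0 ∨ T (x - b - c) 1 := by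
  rcases s.hT.prev_kind h with hp | hp | hp | hp | hp
  · exact .inl hp
  · exact .inr (start_at hp)
  · exact (s.no_22 hp (start_at h)).elim
  · exact (s.no_32 hp (start_at h)).elim
  · exact (s.middle_no_4 hp).elim

theorem before_3 (s : Sandwich b c U T V) (h : T x 3) : T (x - b - c) 1 ∨ T (x - b - c) 2 := by
  rcases s.hT.prev_kind h with hp | hp | hp | hp | hp
  · exact (s.no_03 hp (start_at h)).elim
  · exact .inl (start_at hp)
  · exact .inr (start_at hp)
  · exact (s.no_33 hp (start_at h)).elim
  · exact (s.middle_no_4 hp).elim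

/-- The 4 would feed a 3 of the middle row. Going back from that 3, one soon meets a 2 or a 3, whose
trace in `U` leaves no room for the 4. -/
theorem first_no_4 (s : Sandwich b c U T V) : ¬ U x 4 := by
  intro h
  have := s.bounds
  have h3 : T (x + b) 3 := (s.u4 h).resolve_right s.middle_no_4
  rcases s.before_3 h3 with hp | hp
  · rcases s.before_1 hp with hq | hq | hq
    · have := s.t2 (s.before_0 hq)
      rcases s.hU.next_at this (y := x - 2 * c) with k | k | k | k | k <;> exact s.hU.bad k h
    · exact s.hU.bad (s.t2 hq) h
    · rcases s.t3 hq with k | k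
      · exact s.hU.bad k h
      · exact s.hU.bad k h
  · exact s.hU.bad (s.t2 hp) h

/-- The half-turn of `first_no_4`. -/
theorem last_no_4 (s : Sandwich b c U T V) : ¬ V x 4 := by
  intro h
  have := s.bounds
  have h0 : T (x + 2 * c) 0 := (s.v4 h).resolve_right s.middle_no_4
  rcases s.after_0 h0 with hn | hn
  · exact s.hV.bad h (s.t1 hn)
  · rcases s.after_2 hn with hm | hm | hm
    · rcases s.t0 hm with k | k <;> exact s.hV.bad h k
    · exact s.hV.bad h (s.t1 hm)
    · have := s.t1 (s.after_3 hm)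
      rcases s.hV.next_at h (y := x + 2 * (b + c)) with k | k | k | k | k <;>
        exact s.hV.bad k this

theorem t3_iff (s : Sandwich b c U T V) : T x 3 ↔ U x 0 :=
  ⟨fun h => (s.t3 h).resolve_right s.first_no_4, fun h => (s.u0 h).resolve_right s.middle_no_4⟩

theorem t0_iff (s : Sandwich b c U T V) : T x 0 ↔ V (x - c) 3 :=
  ⟨fun h => (s.t0 h).resolve_right s.last_no_4,
    fun h => start_at ((s.v3 h).resolve_right s.middle_no_4)⟩

end Sandwich

/-! ### Substituting lists of cycles into a parse -/

/-- The list `L` of cycles (position, kind) tiles the interval from `o` to `e`. -/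
def Tiles (b c : ℤ) (e : ℤ) : ℤ → List (ℤ × Fin 5) → Prop
  | o, [] => o = e
  | o, q :: L => q.1 = o ∧ Tiles b c e (o + cyc b c q.2) L

/-- Replace each cycle of kind `k` of `W` by the list `L k` of cycles, at relative positions. -/
def refine (L : Fin 5 → List (ℤ × Fin 5)) (W : ℤ → Fin 5 → Prop) (z : ℤ) (i : Fin 5) : Prop :=
  ∃ k p, (p, i) ∈ L k ∧ W (z - p) k

theorem Tiles.cover {b c e : ℤ} {L : List (ℤ × Fin 5)} {o z : ℤ} (h : Tiles b c e o L)
    (h1 : o ≤ z) (h2 : z < e) : ∃ q ∈ L, q.1 ≤ z ∧ z < q.1 + cyc b c q.2 := by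
  induction L generalizing o with
  | nil => simp only [Tiles] at h; omega
  | cons q L ih =>
    obtain ⟨rfl, h⟩ := h
    by_cases hz : z < q.1 + cyc b c q.2
    · exact ⟨q, by simp, h1, hz⟩
    · obtain ⟨r, hr, h3⟩ := ih h (by omega)
      exact ⟨r, by simp [hr], h3⟩

theorem Tiles.bounds {b c e : ℤ} (hb : 0 < b) (hc : 0 < c) {L : List (ℤ × Fin 5)} {o : ℤ}
    (h : Tiles b c e o L) : o ≤ e ∧ ∀ q ∈ L, o ≤ q.1 ∧ q.1 + cyc b c q.2 ≤ e := by
  induction L generalizing o with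
  | nil => exact ⟨le_of_eq h, by simp⟩
  | cons q L ih =>
    obtain ⟨rfl, h⟩ := h
    obtain ⟨h1, h2⟩ := ih h
    have := le_cyc hb hc q.2
    refine ⟨by omega, ?_⟩
    intro r hr
    rcases List.mem_cons.1 hr with rfl | hr
    · exact ⟨le_rfl, h1⟩
    · have := h2 r hr
      omega

theorem Tiles.sep {b c e : ℤ} (hb : 0 < b) (hc : 0 < c) {L : List (ℤ × Fin 5)} {o : ℤ}
    (h : Tiles b c e o L) {q r : ℤ × Fin 5} (hq : q ∈ L) (hr : r ∈ L) (h1 : q.1 ≤ r.1)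
    (h2 : r.1 < q.1 + cyc b c q.2) : q = r := by
  induction L generalizing o with
  | nil => simp at hq
  | cons s L ih =>
    obtain ⟨rfl, h⟩ := h
    have hb' := (h.bounds hb hc).2
    rcases List.mem_cons.1 hq with rfl | hq' <;> rcases List.mem_cons.1 hr with rfl | hr'
    · rfl
    · have := hb' r hr'
      omega
    · have := hb' q hq'
      have := le_cyc hb hc r.2
      omega
    · exact ih h hq' hr'

/-- The cycles of `W` translated by `o` still cut ℤ into intervals, and each interval is cut by its
list. The offset `o` lets the three rows be shifted relative to one another. -/
theorem IsParse.refine {b c b' c' o : ℤ} {L : Fin 5 → List (ℤ × Fin 5)} {W : ℤ → Fin 5 → Prop}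
    (hb : 0 < b) (hc : 0 < c) (hW : IsParse b' c' W)
    (hL : ∀ k, Tiles b c (o + cyc b' c' k) o (L k)) : IsParse b c (refine L W) where
  hb := hb
  hc := hc
  cover z := by
    obtain ⟨x, k, hx, h1, h2⟩ := hW.cover (z - o)
    obtain ⟨q, hq, h3⟩ := (hL k).cover (z := z - x) (by omega) (by omega)
    exact ⟨x + q.1, q.2, ⟨k, q.1, hq, by convert hx using 1; ring⟩, by omega, by omega⟩
  sep x k y j := by
    rintro ⟨m, p, hp, hm⟩ ⟨n, q, hq, hn⟩ h1 h2
    have h3 := ((hL m).bounds hb hc).2 _ hp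
    have h4 := ((hL n).bounds hb hc).2 _ hq
    have h5 := le_cyc hb hc j
    dsimp only at h3 h4
    have key : x - p = y - q ∧ m = n := by
      rcases le_total (x - p) (y - q) with h | h
      · exact hW.sep _ _ _ _ hm hn h (by omega)
      · have := hW.sep _ _ _ _ hn hm h (by omega)
        exact ⟨this.1.symm, this.2.symm⟩
    obtain ⟨h6, rfl⟩ := key
    have := (hL m).sep hb hc hp hq (by dsimp only; omega) (by dsimp only; omega)
    simp only [Prod.mk.injEq] at this
    exact ⟨by omega, this.2⟩

/-- The start of a cycle of the larger parse lies in a cycle of the smaller one; both belong to the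
larger parse, so they coincide. Hence inclusions suffice in `first_eq` and `last_eq`. -/
theorem IsParse.eq_of_le {b c : ℤ} {S S' : ℤ → Fin 5 → Prop} (h : IsParse b c S)
    (h' : IsParse b c S') (hle : ∀ x k, S x k → S' x k) : S' = S := by
  funext x k
  refine propext ⟨fun hx => ?_, hle x k⟩
  obtain ⟨y, j, hy, h1, h2⟩ := h.cover x
  obtain ⟨rfl, rfl⟩ := h'.sep _ _ _ _ (hle _ _ hy) hx h1 h2
  exact hy

/-- The cycles of the first row that make up one cycle of the composition. -/
def firstRow (b c : ℤ) : Fin 5 → List (ℤ × Fin 5) :=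
  ![[(0, 1), (b + 2 * c, 0)],
    [(0, 1), (b + 2 * c, 1), (2 * b + 4 * c, 0)],
    [(0, 1), (b + 2 * c, 2), (2 * b + 4 * c, 0)],
    [(0, 1), (b + 2 * c, 3)],
    [(0, 1), (b + 2 * c, 1), (2 * b + 4 * c, 3), (3 * b + 5 * c, 0)]]

/-- The cycles of the middle row that make up one cycle of the composition. -/
def middleRow (b c : ℤ) : Fin 5 → List (ℤ × Fin 5) :=
  ![[(c, 2), (b + 2 * c, 3), (b + 3 * c, 1)],
    [(c, 2), (b + 2 * c, 0), (b + 3 * c, 2), (2 * b + 4 * c, 3), (2 * b + 5 * c, 1)],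
    [(c, 2), (b + 2 * c, 0), (b + 3 * c, 1), (2 * b + 4 * c, 3), (2 * b + 5 * c, 1)],
    [(c, 2), (b + 2 * c, 0), (b + 3 * c, 1)],
    [(c, 2), (b + 2 * c, 0), (b + 3 * c, 2), (2 * b + 4 * c, 1), (3 * b + 5 * c, 3),
      (3 * b + 6 * c, 1)]]

/-- The cycles of the last row that make up one cycle of the composition. -/
def lastRow (b c : ℤ) : Fin 5 → List (ℤ × Fin 5) :=
  ![[(b + c, 0), (2 * b + 2 * c, 2)],
    [(b + c, 3), (2 * b + 2 * c, 1), (3 * b + 4 * c, 2)],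
    [(b + c, 3), (2 * b + 2 * c, 2), (3 * b + 4 * c, 2)],
    [(b + c, 3), (2 * b + 2 * c, 2)],
    [(b + c, 3), (2 * b + 2 * c, 0), (3 * b + 3 * c, 2), (4 * b + 5 * c, 2)]]

/-- The rows are sheared: a composed cycle starting at x occupies an interval that begins at x, x +
c and x + b + c in the three rows. The lengths b + 2c and 2b + 3c are those of `T_{n+3}`. -/
theorem tiles_firstRow (b c : ℤ) (k : Fin 5) :
    Tiles c (b + c) (0 + cyc (b + 2 * c) (2 * b + 3 * c) k) 0 (firstRow b c k) := by
  fin_cases k <;> simp [Tiles, firstRow, cyc] <;> omega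

theorem tiles_middleRow (b c : ℤ) (k : Fin 5) :
    Tiles b c (c + cyc (b + 2 * c) (2 * b + 3 * c) k) c (middleRow b c k) := by
  fin_cases k <;> simp [Tiles, middleRow, cyc] <;> omega

theorem tiles_lastRow (b c : ℤ) (k : Fin 5) :
    Tiles c (b + c) (b + c + cyc (b + 2 * c) (2 * b + 3 * c) k) (b + c) (lastRow b c k) := by
  fin_cases k <;> simp [Tiles, lastRow, cyc] <;> omega

theorem refine_iff {L : Fin 5 → List (ℤ × Fin 5)} {W : ℤ → Fin 5 → Prop} {z : ℤ} {i : Fin 5} :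
    refine L W z i ↔ (∃ p, (p, i) ∈ L 0 ∧ W (z - p) 0) ∨ (∃ p, (p, i) ∈ L 1 ∧ W (z - p) 1) ∨
      (∃ p, (p, i) ∈ L 2 ∧ W (z - p) 2) ∨ (∃ p, (p, i) ∈ L 3 ∧ W (z - p) 3) ∨
      (∃ p, (p, i) ∈ L 4 ∧ W (z - p) 4) := by
  constructor
  · rintro ⟨k, p, h, hW⟩
    fin_cases k
    · exact .inl ⟨p, h, hW⟩
    · exact .inr (.inl ⟨p, h, hW⟩)
    · exact .inr (.inr (.inl ⟨p, h, hW⟩))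
    · exact .inr (.inr (.inr (.inl ⟨p, h, hW⟩)))
    · exact .inr (.inr (.inr (.inr ⟨p, h, hW⟩)))
  · rintro (⟨p, h, hW⟩ | ⟨p, h, hW⟩ | ⟨p, h, hW⟩ | ⟨p, h, hW⟩ | ⟨p, h, hW⟩) <;>
      exact ⟨_, p, h, hW⟩

section rows

variable (b c : ℤ) (W : ℤ → Fin 5 → Prop) (y : ℤ)

/-- These four equivalences show that the outer words of the composition are those of `T_{n+3}`,
mark for mark. -/
theorem inS_firstRow :
    inS c (b + c) (refine (firstRow b c) W) y ↔ inS (b + 2 * c) (2 * b + 3 * c) W y := by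
  simp [inS, refine_iff, firstRow]
  ring_nf

theorem inL_firstRow :
    inL (b + c) (refine (firstRow b c) W) y ↔ inL (2 * b + 3 * c) W y := by
  simp [inL, refine_iff, firstRow]
  ring_nf

theorem outS_lastRow :
    outS c (b + c) (refine (lastRow b c) W) y ↔ outS (b + 2 * c) (2 * b + 3 * c) W y := by
  simp [outS, refine_iff, lastRow]
  ring_nf

theorem outL_lastRow :
    outL c (refine (lastRow b c) W) y ↔ outL (b + 2 * c) W y := by
  simp [outL, refine_iff, lastRow]
  ring_nf

/-- Matching holds for the expansion of any `W`, which gives the inclusion of `T_{n+3}` in the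
composition. -/
theorem interface_first_middle :
    Interface c (b + c) (refine (firstRow b c) W) b c (refine (middleRow b c) W) := by
  constructor <;> intro y
  · simp [outS, inS, refine_iff, firstRow, middleRow]
  · simp [outL, inL, refine_iff, firstRow, middleRow, or_and_right, exists_or]
    ring_nf

theorem interface_middle_last :
    Interface b c (refine (middleRow b c) W) c (b + c) (refine (lastRow b c) W) := by
  constructor <;> intro y
  · simp [outS, inS, refine_iff, lastRow, middleRow]
    ring_nf
  · simp [outL, inL, refine_iff, lastRow, middleRow, or_and_right, exists_or]
    ring_nf

end rows

/-! ### The composition recovered from its middle row -/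

/-- Boundaries of the cycles of the composition, in terms of its middle row. -/
def Joint (b c : ℤ) (T : ℤ → Fin 5 → Prop) (x : ℤ) : Prop := T (x - b) 1 ∧ T (x + c) 2

/-- The parse of the composition, in terms of its middle row. -/
def merge (b c : ℤ) (T : ℤ → Fin 5 → Prop) (x : ℤ) (k : Fin 5) : Prop :=
  Joint b c T x ∧
    -- After the factor 1 2 of the joint come 3, or 0 2 3, or 0 1 3, or 0 1 2, or 0 2 1. This is
    -- enough to tell the five words apart; the rest up to the next joint is forced.
    ![T (x + b + 2 * c) 3,
      T (x + b + 2 * c) 0 ∧ T (x + b + 3 * c) 2 ∧ T (x + 2 * b + 4 * c) 3,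
      T (x + b + 2 * c) 0 ∧ T (x + b + 3 * c) 1 ∧ T (x + 2 * b + 4 * c) 3,
      T (x + b + 2 * c) 0 ∧ T (x + b + 3 * c) 1 ∧ T (x + 2 * b + 4 * c) 2,
      T (x + b + 2 * c) 0 ∧ T (x + b + 3 * c) 2 ∧ T (x + 2 * b + 4 * c) 1] k

namespace Sandwich

variable {b c : ℤ} {U T V : ℤ → Fin 5 → Prop} {x y z : ℤ} {k : Fin 5}

/-- This distance is that of the factor 3 1 3. The traces in `U`, of kind 0 and length b + c, would
leave a gap of length c, too short for a cycle of `U`. -/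
theorem no_3_3 (s : Sandwich b c U T V) (h : T x 3) (h' : T y 3) (e : y = x + b + 2 * c) :
    False := by
  have := s.bounds
  exact s.hU.bad (s.t3_iff.1 h) (s.t3_iff.1 h')

/-- Excludes the factor 0 2 0, the half-turn of 3 1 3. -/
theorem no_0_0 (s : Sandwich b c U T V) (h : T x 0) (h' : T y 0) (e : y = x + b + 2 * c) :
    False := by
  have := s.bounds
  exact s.hV.bad (s.t0_iff.1 h) (s.t0_iff.1 h')

/-- The alternative 1 2 1 would leave a gap of length b between two cycles of `V`; `after_21`
excludes 2 1 2 likewise in `U`. -/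
theorem before_21 (s : Sandwich b c U T V) (h : T x 2) (h' : T (x + b + c) 1) : T (x - c) 0 := by
  have := s.bounds
  refine (s.before_2 h).resolve_right fun hp => ?_
  exact s.hV.bad (s.t1 hp) (s.t1 h')

theorem after_21 (s : Sandwich b c U T V) (h : T x 2) (h' : T (x + b + c) 1) :
    T (x + 2 * b + 2 * c) 3 := by
  have := s.bounds
  rcases s.after_1 h' with hn | hn
  · exact (s.hU.bad (s.t2 h) (s.t2 hn)).elim
  · exact start_at hn

theorem after_joint (s : Sandwich b c U T V) (h : Joint b c T x) :
    T (x + b + 2 * c) 0 ∨ T (x + b + 2 * c) 3 := by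
  have := s.bounds
  obtain ⟨h1, h2⟩ := h
  rcases s.after_2 h2 with h | h | h
  · exact .inl (start_at h)
  · exact (s.hT.bad h1 (s.before_21 h2 h)).elim
  · exact .inr (start_at h)

theorem merge_exists (s : Sandwich b c U T V) (h : Joint b c T x) : ∃ k, merge b c T x k := by
  have := s.bounds
  rcases s.after_joint h with h0 | h3
  · rcases s.after_0 h0 with h1 | h2
    · rcases s.after_1 h1 with h2 | h3
      · exact ⟨3, h, h0, start_at h1, start_at h2⟩
      · exact ⟨2, h, h0, start_at h1, start_at h3⟩
    · rcases s.after_2 h2 with h4 | h1 | h3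
      · exact (s.no_0_0 h0 h4 (by omega)).elim
      · exact ⟨4, h, h0, start_at h2, start_at h1⟩
      · exact ⟨1, h, h0, start_at h2, start_at h3⟩
  · exact ⟨0, h, h3⟩

/-- A cycle of kind `3` is followed by a boundary, if it is not too close to another one. -/
theorem joint_of_3 (s : Sandwich b c U T V) (h : T x 3) (h' : ¬ T (x + b + 2 * c) 3) :
    Joint b c T (x + b + c) := by
  have h1 := s.after_3 h
  refine ⟨start_at h1, ?_⟩
  rcases s.after_1 h1 with hn | hn
  · exact start_at hn
  · exact (h' (start_at hn)).elim

theorem merge_middle (s : Sandwich b c U T V) (h : merge b c T x k) :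
    (∀ q ∈ middleRow b c k, T (x + q.1) q.2) ∧
      Joint b c T (x + cyc (b + 2 * c) (2 * b + 3 * c) k) := by
  have := s.bounds
  obtain ⟨hj, h⟩ := h
  have hj2 := hj.2
  have no33 : ∀ z, T z 3 → ¬ T (z + b + 2 * c) 3 := fun z h h' => s.no_3_3 h h' rfl
  fin_cases k
  · have h3 : T (x + b + 2 * c) 3 := h
    have h4 := s.joint_of_3 h3 (no33 _ h3)
    have h5 := s.after_3 h3
    refine ⟨?_, by convert h4 using 1; simp [cyc]; ring⟩
    simpa [middleRow, ← add_assoc, hj2, h3] using start_at h5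
  · obtain ⟨h0, h2, h3⟩ : _ ∧ _ ∧ _ := h
    have h4 := s.joint_of_3 h3 (no33 _ h3)
    have h5 := s.after_3 h3
    refine ⟨?_, by convert h4 using 1; simp [cyc]; ring⟩
    simpa [middleRow, ← add_assoc, hj2, h0, h2, h3] using start_at h5
  · obtain ⟨h0, h1, h3⟩ : _ ∧ _ ∧ _ := h
    have h4 := s.joint_of_3 h3 (no33 _ h3)
    have h5 := s.after_3 h3
    refine ⟨?_, by convert h4 using 1; simp [cyc]; ring⟩
    simpa [middleRow, ← add_assoc, hj2, h0, h1, h3] using start_at h5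
  · obtain ⟨h0, h1, h2⟩ : _ ∧ _ ∧ _ := h
    refine ⟨?_, start_at h1 (by simp [cyc]; ring), start_at h2 (by simp [cyc]; ring)⟩
    simp [middleRow, ← add_assoc, hj2, h0, h1]
  · obtain ⟨h0, h2, h1⟩ : _ ∧ _ ∧ _ := h
    have h3 : T (x + 3 * b + 5 * c) 3 := start_at (s.after_21 h2 (start_at h1))
    have h4 := s.joint_of_3 h3 (no33 _ h3)
    have h5 := s.after_3 h3
    refine ⟨?_, by convert h4 using 1; simp [cyc]; ring⟩
    simpa [middleRow, ← add_assoc, hj2, h0, h1, h2, h3] using start_at h5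

/-- Backwards from a 2 one reads 1 2, or else 1 2 0 2, because 0 2 0 is excluded. -/
theorem joint_of_2 (s : Sandwich b c U T V) (h : T z 2) : ∃ x ≤ z, Joint b c T x := by
  have := s.bounds
  rcases s.before_2 h with h0 | h1
  · have h2 := s.before_0 h0
    rcases s.before_2 h2 with h0' | h1
    · exact (s.no_0_0 h0' h0 (by omega)).elim
    · exact ⟨z - b - 3 * c, by omega, start_at h1, start_at h2⟩
  · exact ⟨z - c, by omega, start_at h1, start_at h⟩

theorem joint_below (s : Sandwich b c U T V) (z : ℤ) : ∃ x ≤ z, Joint b c T x := by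
  have := s.bounds
  have of_2 : ∀ y, y ≤ z → T y 2 → ∃ x ≤ z, Joint b c T x := fun y hy h => by
    obtain ⟨x, hx, h⟩ := s.joint_of_2 h
    exact ⟨x, by omega, h⟩
  have of_0 : ∀ y, y ≤ z → T y 0 → ∃ x ≤ z, Joint b c T x := fun y hy h =>
    of_2 _ (by omega) (s.before_0 h)
  have of_3 : ∀ y, y ≤ z → T y 3 → ∃ x ≤ z, Joint b c T x := fun y hy h => by
    rcases s.before_3 h with h1 | h2
    · rcases s.before_1 h1 with h | h | h'
      · exact of_0 _ (by omega) h
      · exact of_2 _ (by omega) h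
      · exact (s.no_3_3 h' h (by omega)).elim
    · exact of_2 _ (by omega) h2
  obtain ⟨y, k, hy, hyz, -⟩ := s.hT.cover z
  fin_cases k
  · exact of_0 y hyz hy
  · rcases s.before_1 hy with h | h | h
    · exact of_0 _ (by omega) h
    · exact of_2 _ (by omega) h
    · exact of_3 _ (by omega) h
  · exact of_2 y hyz hy
  · exact of_3 y hyz hy
  · exact (s.middle_no_4 hy).elim

theorem isParse_merge (s : Sandwich b c U T V) :
    IsParse (b + 2 * c) (2 * b + 3 * c) (merge b c T) := by
  have hbd := s.bounds
  refine IsParse.of_boundary (B := Joint b c T) (by omega) (by omega) (fun x k h => h.1)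
    (fun x h => s.merge_exists h) (fun x k h => (s.merge_middle h).2) ?_ ?_
    (fun z => s.joint_below z)
  · rintro x k j ⟨-, h⟩ ⟨-, h'⟩
    fin_cases k <;> fin_cases j <;> first
      | rfl
      | exact (s.hT.bad_kind (h : T _ _) (h' : T _ _ ∧ _).1).elim
      | exact (s.hT.bad_kind (h : T _ _ ∧ _).1 (h' : T _ _)).elim
      | exact (s.hT.bad_kind (h : T _ _ ∧ T _ _ ∧ _).2.1 (h' : T _ _ ∧ T _ _ ∧ _).2.1).elim
      | exact (s.hT.bad_kind (h : T _ _ ∧ T _ _ ∧ T _ _).2.2 (h' : T _ _ ∧ T _ _ ∧ T _ _).2.2).elim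
  · intro x k y h hy hxy
    by_contra hlt
    have hm := (s.merge_middle h).1
    obtain ⟨q, hq, h1, h2⟩ := (tiles_middleRow b c k).cover (z := y + c - x) (by omega) (by omega)
    have h3 := s.hT.sep _ _ _ _ (hm q hq) hy.2 (by omega) (by omega)
    have h4 := hy.1
    have h5 : T (x + c) 2 := h.1.2
    obtain ⟨p, i⟩ := q
    obtain ⟨h6, rfl⟩ : x + p = y + c ∧ i = 2 := h3
    -- The joint at `y` places a 1 just before this 2, so any cycle of the word that starts within b
    -- + c before the 2 must be that 1.
    have h7 : ∀ p' i', (p', i') ∈ middleRow b c k → p' < p →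
        p ≤ p' + (b + c) → p' = p - (b + c) ∧ i' = 1 := by
      intro p' i' hp' hlt hle
      by_cases hpp : p' = p - (b + c)
      · exact ⟨hpp, s.hT.kind_unique (hm _ hp') (start_at h4)⟩
      · rcases lt_or_gt_of_ne hpp with hpp | hpp
        · omega
        · exact (s.hT.bad h4 (hm _ hp') (.inl ⟨by dsimp only; omega,
            by simp only [cyc_1]; omega, by simp only [cyc_1]; omega⟩)).elim
    -- A 2 that is not the first cycle of its word comes right after the 0 at `b + 2 * c`.
    have h8 := h7 (b + 2 * c) 0
    fin_cases k <;> simp [middleRow] at hq h8 <;> omega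

/-- Kinds 0 and 1 of `U` write marks, so they are dictated by the 3s and 2s of `T`. Kinds 2 and 3
write none and are found by elimination: another kind would need a mark absent from `T` or have the
wrong length. -/
theorem first_eq (s : Sandwich b c U T V) : U = refine (firstRow b c) (merge b c T) := by
  have := s.bounds
  have hpos : 0 < b + c := by omega
  refine (s.isParse_merge.refine s.hT.hc hpos (tiles_firstRow b c)).eq_of_le s.hU ?_
  rintro z i ⟨k, p, hp, hx⟩
  obtain ⟨x, rfl⟩ : ∃ x, z = x + p := ⟨z - p, by ring⟩
  rw [add_sub_cancel_right] at hx
  revert i p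
  suffices h : ∀ q ∈ firstRow b c k, U (x + q.1) q.2 from fun p i hp => h _ hp
  obtain ⟨hm, hend⟩ := s.merge_middle hx
  have h0 : U x 1 := start_at (s.t2 hx.1.2)
  fin_cases k <;> simp [middleRow, firstRow] at hm ⊢
  · exact ⟨h0, s.t3_iff.1 hm.2.1⟩
  · exact ⟨h0, start_at (s.t2 hm.2.2.1), s.t3_iff.1 hm.2.2.2.1⟩
  · obtain ⟨-, m0, m1, m3, -⟩ := hm
    have h2 := s.t3_iff.1 m3
    refine ⟨h0, ?_, h2⟩
    rcases s.hU.next_at h0 (y := x + (b + 2 * c)) with h | h | h | h | h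
    · exact (s.hU.bad h h2).elim
    · exact (s.hT.bad_kind m1 (s.u1 h)).elim
    · exact h
    · exact (s.hU.bad h h2).elim
    · exact (s.first_no_4 h).elim
  · obtain ⟨-, m0, m1⟩ := hm
    have h2 : U (x + (2 * b + 3 * c)) 1 := start_at (s.t2 hend.2) (by simp [cyc])
    refine ⟨h0, ?_⟩
    rcases s.hU.next_at h0 (y := x + (b + 2 * c)) with h | h | h | h | h
    · exact (s.hT.bad_kind m0 (s.t3_iff.2 h)).elim
    · exact (s.hT.bad_kind m1 (s.u1 h)).elim
    · exact (s.hU.bad h h2).elim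
    · exact h
    · exact (s.first_no_4 h).elim
  · obtain ⟨-, m0, m2, m1, m3, -⟩ := hm
    have h1 : U (x + (b + 2 * c)) 1 := start_at (s.t2 m2)
    have h2 := s.t3_iff.1 m3
    refine ⟨h0, h1, ?_, h2⟩
    rcases s.hU.next_at h1 (y := x + (2 * b + 4 * c)) with h | h | h | h | h
    · exact (s.hT.bad_kind m1 (s.t3_iff.2 h)).elim
    · exact (s.hU.bad h h2).elim
    · exact (s.hU.bad h h2).elim
    · exact h
    · exact (s.first_no_4 h).elim

/-- Now kinds 2 and 3 of `V` are dictated by the 1s and 0s of `T`, and kinds 0 and 1, which read no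
mark, are found by elimination. -/
theorem last_eq (s : Sandwich b c U T V) : V = refine (lastRow b c) (merge b c T) := by
  have := s.bounds
  have hpos : 0 < b + c := by omega
  refine (s.isParse_merge.refine s.hT.hc hpos (tiles_lastRow b c)).eq_of_le s.hV ?_
  rintro z i ⟨k, p, hp, hx⟩
  obtain ⟨x, rfl⟩ : ∃ x, z = x + p := ⟨z - p, by ring⟩
  rw [add_sub_cancel_right] at hx
  revert i p
  suffices h : ∀ q ∈ lastRow b c k, V (x + q.1) q.2 from fun p i hp => h _ hp
  obtain ⟨hm, -⟩ := s.merge_middle hx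
  have hstart := s.hV.next_at (s.t1 hx.1.1) (y := x + (b + c))
  have of_0 : T (x + (b + 2 * c)) 0 → V (x + (b + c)) 3 := fun h => start_at (s.t0_iff.1 h)
  fin_cases k <;> simp [middleRow, lastRow] at hm ⊢
  · obtain ⟨-, m3, m1⟩ := hm
    have h2 : V (x + (2 * b + 2 * c)) 2 := start_at (s.t1 m1)
    refine ⟨?_, h2⟩
    rcases hstart with h | h | h | h | h
    · exact h
    · exact (s.hV.bad h h2).elim
    · exact (s.hV.bad h h2).elim
    · exact (s.hT.bad_kind m3 (s.t0_iff.2 (start_at h : V (x + (b + 2 * c) - c) 3))).elim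
    · exact (s.last_no_4 h).elim
  · obtain ⟨-, m0, m2, m3, m1⟩ := hm
    have h1 := of_0 m0
    have h2 : V (x + (3 * b + 4 * c)) 2 := start_at (s.t1 m1)
    refine ⟨h1, ?_, h2⟩
    rcases s.hV.next_at h1 (y := x + (2 * b + 2 * c)) with h | h | h | h | h
    · exact (s.hV.bad h h2).elim
    · exact h
    · exact (s.hT.bad_kind m2 (s.v2 h)).elim
    · exact (s.hV.bad h h2).elim
    · exact (s.last_no_4 h).elim
  · obtain ⟨-, m0, m1, m3, m1'⟩ := hm
    exact ⟨of_0 m0, start_at (s.t1 m1), start_at (s.t1 m1')⟩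
  · obtain ⟨-, m0, m1⟩ := hm
    exact ⟨of_0 m0, start_at (s.t1 m1)⟩
  · obtain ⟨-, m0, m2, m1, m3, m1'⟩ := hm
    have h1 := of_0 m0
    have h2 : V (x + (3 * b + 3 * c)) 2 := start_at (s.t1 m1)
    refine ⟨h1, ?_, h2, start_at (s.t1 m1')⟩
    rcases s.hV.next_at h1 (y := x + (2 * b + 2 * c)) with h | h | h | h | h
    · exact h
    · exact (s.hV.bad h h2).elim
    · exact (s.hV.bad h h2).elim
    · have h4 : T (x + 2 * b + 3 * c) 0 := s.t0_iff.2 (start_at h)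
      exact (s.hT.bad m2 h4).elim
    · exact (s.last_no_4 h).elim

/-- Five alternating rows are impossible. -/
theorem no_chain {T' V' : ℤ → Fin 5 → Prop} (s : Sandwich b c U T V)
    (s' : Sandwich b c V T' V') : False := by
  have hV := s.last_eq
  have hV' := s'.first_eq
  have hW := s'.isParse_merge
  set W := merge b c T
  set W' := merge b c T'
  -- As a last row, `V` contains 1 only within the word 3 1 2.
  have key : ∀ z, V z 1 → V (z - b - c) 3 ∧ V (z + b + 2 * c) 2 := by
    intro z hz
    rw [hV] at hz ⊢
    simp only [refine_iff, lastRow] at hz ⊢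
    have hz : W (z - (2 * b + 2 * c)) 1 := by simpa using hz
    constructor
    · right; left
      exact ⟨b + c, by simp, by convert hz using 1; ring⟩
    · right; left
      exact ⟨3 * b + 4 * c, by simp, by convert hz using 1; ring⟩
  have mem : ∀ x k p i, W' x k → (p, i) ∈ firstRow b c k → V (x + p) i := by
    intro x k p i hx hp
    rw [hV']
    exact ⟨k, p, hp, by simpa using hx⟩
  -- As a first row, `V` is made of words that begin with 1, so by `key` it contains a 3. Only the
  -- words 1 3 and 1 1 3 0 do, and in both the initial 1 is not followed by 2.
  obtain ⟨x, k, hx, -⟩ := hW.cover 0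
  have h1 : V x 1 := start_at (mem x k 0 1 hx (by fin_cases k <;> simp [firstRow]))
  have h3 := (key x h1).1
  rw [hV', refine_iff] at h3
  have h3 : (∃ z, W' z 3) ∨ ∃ z, W' z 4 := by
    simp [firstRow] at h3
    exact h3.imp (fun h => ⟨_, h⟩) (fun h => ⟨_, h⟩)
  rcases h3 with ⟨z, hz⟩ | ⟨z, hz⟩
  · exact s.hV.bad_kind (key z (start_at (mem z 3 0 1 hz (by simp [firstRow])))).2
      (mem z 3 (b + 2 * c) 3 hz (by simp [firstRow]))
  · exact s.hV.bad_kind (key z (start_at (mem z 4 0 1 hz (by simp [firstRow])))).2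
      (mem z 4 (b + 2 * c) 1 hz (by simp [firstRow]))

end Sandwich

/-! ### Recovering the marks from the words -/

/-- Letters of the blocks `110` (short marks `P`) and `111` (long marks `Q`) on a background of
zeros that differ from the background; a mark is the position just after its block. -/
def loWord (P Q : ℤ → Prop) (y : ℤ) : Prop := P (y + 3) ∨ P (y + 2) ∨ Q (y + 3) ∨ Q (y + 2) ∨ Q (y + 1)

/-- Letters of the blocks `100` (short marks `P`) and `000` (long marks `Q`) on a background of
ones that differ from the background; a mark is the position just after its block. -/
def hiWord (P Q : ℤ → Prop) (y : ℤ) : Prop := P (y + 2) ∨ P (y + 1) ∨ Q (y + 3) ∨ Q (y + 2) ∨ Q (y + 1)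

/-- Short marks `P` and long marks `Q` at mutual distances at least `5`. -/
structure Spaced (P Q : ℤ → Prop) : Prop where
  disjoint : ∀ y, P y → ¬ Q y
  gap : ∀ x y, P x ∨ Q x → P y ∨ Q y → x < y → x + 5 ≤ y

namespace Spaced

variable {P Q P' Q' : ℤ → Prop} {y : ℤ}

theorem clear (h : Spaced P Q) {x : ℤ} (hx : P x ∨ Q x) (z : ℤ) (h1 : x - 5 < z) (h2 : z < x + 5)
    (h3 : z ≠ x) : ¬ P z ∧ ¬ Q z := by
  rw [← not_or]
  intro hz
  rcases lt_or_gt_of_ne h3 with h4 | h4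
  · have := h.gap z x hz hx h4
    omega
  · have := h.gap x z hx hz h4
    omega

theorem not_hiWord (h : Spaced P Q) (hy : P y ∨ Q y) : ¬ hiWord P Q y := by
  have h1 := h.clear hy (y + 1) (by omega) (by omega) (by omega)
  have h2 := h.clear hy (y + 2) (by omega) (by omega) (by omega)
  have h3 := h.clear hy (y + 3) (by omega) (by omega) (by omega)
  simp [hiWord, h1, h2, h3]

/-- Blocks 100 and 000 differ from the background up to their last letter, so a mark is where the
word returns to the background; the letter at `y - 3` tells the length. -/
theorem hiWord_iff (h : Spaced P Q) : P y ∨ Q y ↔ hiWord P Q (y - 1) ∧ ¬ hiWord P Q y := by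
  constructor
  · refine fun hy => ⟨?_, h.not_hiWord hy⟩
    have e1 : y - 1 + 1 = y := by ring
    rcases hy with hy | hy <;> simp [hiWord, e1, hy]
  · simp only [hiWord, show y - 1 + 1 = y by ring, show y - 1 + 2 = y + 1 by ring,
      show y - 1 + 3 = y + 2 by ring]
    tauto

theorem hiWord_long_iff (h : Spaced P Q) : Q y ↔ (P y ∨ Q y) ∧ hiWord P Q (y - 3) := by
  constructor
  · intro hy
    exact ⟨.inr hy, by simp [hiWord, hy]⟩
  · rintro ⟨hy, hw⟩
    have h1 := h.clear hy (y - 1) (by omega) (by omega) (by omega)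
    have h2 := h.clear hy (y - 2) (by omega) (by omega) (by omega)
    simpa [hiWord, show y - 3 + 1 = y - 2 by ring, show y - 3 + 2 = y - 1 by ring, h1, h2] using hw

/-- Blocks 110 and 111 differ from the background from their first letter on, so a mark is found
three letters after the word leaves the background; the letter at `y - 1` tells the length. -/
theorem loWord_iff (h : Spaced P Q) : P y ∨ Q y ↔ loWord P Q (y - 3) ∧ ¬ loWord P Q (y - 4) := by
  constructor
  · intro hy
    have h1 := h.clear hy (y - 1) (by omega) (by omega) (by omega)
    have h2 := h.clear hy (y - 2) (by omega) (by omega) (by omega)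
    have h3 := h.clear hy (y - 3) (by omega) (by omega) (by omega)
    simp only [loWord, show y - 3 + 3 = y by ring, show y - 4 + 3 = y - 1 by ring,
      show y - 4 + 2 = y - 2 by ring, show y - 4 + 1 = y - 3 by ring]
    tauto
  · simp only [loWord, show y - 3 + 3 = y by ring, show y - 3 + 2 = y - 1 by ring,
      show y - 3 + 1 = y - 2 by ring, show y - 4 + 3 = y - 1 by ring,
      show y - 4 + 2 = y - 2 by ring]
    tauto

theorem loWord_long_iff (h : Spaced P Q) : Q y ↔ (P y ∨ Q y) ∧ loWord P Q (y - 1) := by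
  constructor
  · intro hy
    exact ⟨.inr hy, by simp [loWord, hy]⟩
  · rintro ⟨hy, hw⟩
    have h1 := h.clear hy (y + 1) (by omega) (by omega) (by omega)
    have h2 := h.clear hy (y + 2) (by omega) (by omega) (by omega)
    simpa [loWord, show y - 1 + 2 = y + 1 by ring, show y - 1 + 3 = y + 2 by ring, h1, h2] using hw

theorem eq_of_loWord (h : Spaced P Q) (h' : Spaced P' Q')
    (e : ∀ y, loWord P Q y ↔ loWord P' Q' y) : (∀ y, P y ↔ P' y) ∧ ∀ y, Q y ↔ Q' y := by
  have h1 : ∀ y, P y ∨ Q y ↔ P' y ∨ Q' y := fun y => by rw [h.loWord_iff, h'.loWord_iff, e, e]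
  have h2 : ∀ y, Q y ↔ Q' y := fun y => by rw [h.loWord_long_iff, h'.loWord_long_iff, e, h1]
  refine ⟨fun y => ?_, h2⟩
  have := h.disjoint y
  have := h'.disjoint y
  have := h1 y
  have := h2 y
  tauto

theorem eq_of_hiWord (h : Spaced P Q) (h' : Spaced P' Q')
    (e : ∀ y, hiWord P Q y ↔ hiWord P' Q' y) : (∀ y, P y ↔ P' y) ∧ ∀ y, Q y ↔ Q' y := by
  have h1 : ∀ y, P y ∨ Q y ↔ P' y ∨ Q' y := fun y => by rw [h.hiWord_iff, h'.hiWord_iff, e, e]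
  have h2 : ∀ y, Q y ↔ Q' y := fun y => by rw [h.hiWord_long_iff, h'.hiWord_long_iff, e, h1]
  refine ⟨fun y => ?_, h2⟩
  have := h.disjoint y
  have := h'.disjoint y
  have := h1 y
  have := h2 y
  tauto

theorem exists_not_hiWord (h : Spaced P Q) (y : ℤ) : ∃ z, y ≤ z ∧ z ≤ y + 3 ∧ ¬ hiWord P Q z := by
  by_cases hy : hiWord P Q y
  · rcases hy with hy | hy | hy | hy | hy
    · exact ⟨_, by omega, by omega, h.not_hiWord (.inl hy)⟩
    · exact ⟨_, by omega, by omega, h.not_hiWord (.inl hy)⟩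
    all_goals exact ⟨_, by omega, by omega, h.not_hiWord (.inr hy)⟩
  · exact ⟨y, le_rfl, by omega, hy⟩

/-- A word with a background of zeros is not a word with a background of ones. -/
theorem lo_ne_hi (h : Spaced P Q) (h' : Spaced P' Q')
    (after : ∀ x y, Q x → P y ∨ Q y → x < y → x + 8 ≤ y)
    (before : ∀ x y, P' x ∨ Q' x → Q' y → x < y → x + 8 ≤ y)
    (e : ∀ y, loWord P Q y ↔ ¬ hiWord P' Q' y) : False := by
  -- On the background of ones, any four consecutive letters include a 1; but `after` leaves five
  -- zeros after a block 111.
  have noQ : ∀ m, ¬ Q m := by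
    intro m hm
    have far : ∀ z, m < z → z < m + 8 → ¬ (P z ∨ Q z) := fun z h1 h2 h3 => by
      have := after m z hm h3 h1
      omega
    obtain ⟨z, h1, h2, h3⟩ := h'.exists_not_hiWord m
    rcases (e z).2 h3 with h | h | h | h | h
    · exact far _ (by omega) (by omega) (.inl h)
    · exact far _ (by omega) (by omega) (.inl h)
    all_goals exact far _ (by omega) (by omega) (.inr h)
  obtain ⟨m, hm⟩ : ∃ m, P m := by
    obtain ⟨z, -, -, h3⟩ := h'.exists_not_hiWord 0
    rcases (e z).2 h3 with h | h | h | h | h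
    · exact ⟨_, h⟩
    · exact ⟨_, h⟩
    all_goals exact (noQ _ h).elim
  have h1 := h.clear (.inl hm) (m - 1) (by omega) (by omega) (by omega)
  have h2 := h.clear (.inl hm) (m - 2) (by omega) (by omega) (by omega)
  have h3 := h.clear (.inl hm) (m + 1) (by omega) (by omega) (by omega)
  have h4 := h.clear (.inl hm) (m + 2) (by omega) (by omega) (by omega)
  -- Only blocks 110 remain. The letters from m - 4 to m - 1 are 0 1 1 0, so one block of zeros ends
  -- at m - 3 and the next has its first zero at m - 1: their marks are too close.
  have l1 : hiWord P' Q' (m - 4) := by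
    by_contra hc
    rcases (e _).2 hc with h | h | h | h | h
    · exact h1.1 (by convert h using 1; ring)
    · exact h2.1 (by convert h using 1; ring)
    all_goals exact noQ _ h
  have l2 : ¬ hiWord P' Q' (m - 3) := (e _).1 (.inl (by convert hm using 1; ring))
  have l3 : ¬ hiWord P' Q' (m - 2) := (e _).1 (.inr (.inl (by convert hm using 1; ring)))
  have l4 : hiWord P' Q' (m - 1) := by
    by_contra hc
    rcases (e _).2 hc with h | h | h | h | h
    · exact h4.1 (by convert h using 1; ring)
    · exact h3.1 (by convert h using 1; ring)
    all_goals exact noQ _ h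
  have hA : P' (m - 3) ∨ Q' (m - 3) := h'.hiWord_iff.2 ⟨by convert l1 using 1; ring, l2⟩
  have hB : P' (m + 1) ∨ Q' (m + 2) := by
    simp only [hiWord, show m - 1 + 1 = m by ring, show m - 1 + 2 = m + 1 by ring,
      show m - 1 + 3 = m + 2 by ring] at l4
    simp only [hiWord, show m - 2 + 1 = m - 1 by ring, show m - 2 + 2 = m by ring,
      show m - 2 + 3 = m + 1 by ring] at l3
    tauto
  rcases hB with hB | hB
  · have := h'.gap _ _ hA (.inl hB) (by omega)
    omega
  · have := before _ _ hA hB (by omega)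
    omega

end Spaced

namespace IsParse

variable {b c : ℤ} {S : ℤ → Fin 5 → Prop} {x y : ℤ} {k j : Fin 5}

theorem clash (hS : IsParse b c S) (h1 : S x k) (h2 : S y j)
    (h3 : x < y + cyc b c j := by simp only [cyc_0, cyc_1, cyc_2, cyc_3, cyc_4]; omega)
    (h4 : y < x + cyc b c k := by simp only [cyc_0, cyc_1, cyc_2, cyc_3, cyc_4]; omega) :
    x = y ∧ k = j := by
  rcases le_total x y with h | h
  · exact hS.sep _ _ _ _ h1 h2 h h4
  · exact (hS.sep _ _ _ _ h2 h1 h h3).imp Eq.symm Eq.symm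

theorem in_gap (hS : IsParse b c S) (hbc : b < c) (hx : inS b c S x ∨ inL c S x)
    (hy : inS b c S y ∨ inL c S y) (hxy : x < y) : x + c ≤ y := by
  have := hS.hb
  by_contra hlt
  rcases hx with (hx | hx) | hx <;> rcases hy with (hy | hy) | hy <;>
    · have := hS.clash hx hy
      simp at this
      try omega

theorem in_gap_long (hS : IsParse b c S) (hbc : b < c) (hx : inL c S x)
    (hy : inS b c S y ∨ inL c S y) (hxy : x < y) : x + b + c ≤ y := by
  have := hS.hb
  by_contra hlt
  unfold inL at hx
  rcases hy with (hy | hy) | hy <;>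
    · have := hS.clash hx hy
      simp at this
      try omega

theorem out_gap (hS : IsParse b c S) (hbc : b < c) (hcb : c < 2 * b)
    (hx : outS b c S x ∨ outL b S x) (hy : outS b c S y ∨ outL b S y) (hxy : x < y) :
    x + c ≤ y := by
  have := hS.hb
  by_contra hlt
  rcases hx with (hx | hx) | hx <;> rcases hy with (hy | hy) | hy <;>
    · have := hS.clash hx hy
      simp at this
      try omega

theorem out_gap_long (hS : IsParse b c S) (hbc : b < c) (hcb : c < 2 * b)
    (hx : outS b c S x ∨ outL b S x) (hy : outL b S y) (hxy : x < y) : x + b + c ≤ y := by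
  have := hS.hb
  by_contra hlt
  unfold outL at hy
  rcases hx with (hx | hx) | hx <;>
    · have := hS.clash hx hy
      simp at this
      try omega

theorem spaced_in (hS : IsParse b c S) (hbc : b < c) (hc : 5 ≤ c) :
    Spaced (inS b c S) (inL c S) where
  disjoint y := by
    have := hS.hb
    unfold inL
    rintro (hx | hx) hy <;>
      · have := hS.clash hx hy
        simp at this
  gap x y hx hy hxy := by
    have := hS.in_gap hbc hx hy hxy
    omega

theorem spaced_out (hS : IsParse b c S) (hbc : b < c) (hcb : c < 2 * b) (hc : 5 ≤ c) :
    Spaced (outS b c S) (outL b S) where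
  disjoint y := by
    have := hS.hb
    unfold outL
    rintro (hx | hx) hy <;>
      · have := hS.clash hx hy
        simp at this
  gap x y hx hy hxy := by
    have := hS.out_gap hbc hcb hx hy hxy
    omega

end IsParse

/-! ### Runs of a compact transducer as parses -/

/-- The state reached after `i` letters of the cycle made of the trunk and the petal `k`. -/
def cycleNode {K : Type} {a : ℕ} {l : K → ℕ} (k : K) (i : ℕ) : CompactState a l :=
  if h : i < a + 1 then Sum.inl ⟨i, h⟩ else petalNode k (i - a)

section cycleNode

variable {K : Type} {a : ℕ} {l : K → ℕ} {k k' : K} {i i' : ℕ}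

theorem cycleNode_zero : (cycleNode k 0 : CompactState a l) = Sum.inl 0 := by
  simp [cycleNode]

theorem cycleNode_inner (h1 : a < i) (h2 : i < a + l k) :
    (cycleNode k i : CompactState a l) = Sum.inr ⟨k, ⟨i - a - 1, by omega⟩⟩ := by
  rw [cycleNode, dif_neg (by omega), petalNode, if_neg (by omega), dif_pos (by omega)]

theorem cycleNode_end (hl : 2 ≤ l k) : (cycleNode k (a + l k) : CompactState a l) = Sum.inl 0 := by
  rw [cycleNode, dif_neg (by omega), petalNode, if_neg (by omega), dif_neg (by omega)]

theorem cycleNode_trunk (h : i ≤ a) :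
    (cycleNode k i : CompactState a l) = cycleNode k' i := by
  rw [cycleNode, cycleNode, dif_pos (by omega), dif_pos (by omega)]

/-- All cycles share the states of the trunk, including both its ends, so the petal is known only
strictly beyond it. -/
theorem cycleNode_inj (hi : i < a + l k) (hi' : i' < a + l k')
    (h : (cycleNode k i : CompactState a l) = cycleNode k' i') : i = i' ∧ (a < i → k = k') := by
  rcases lt_or_ge a i with h1 | h1 <;> rcases lt_or_ge a i' with h2 | h2
  · rw [cycleNode_inner h1 hi, cycleNode_inner h2 hi'] at h
    simp only [Sum.inr.injEq, Sigma.mk.injEq] at h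
    obtain ⟨rfl, h⟩ := h
    simp only [heq_eq_eq, Fin.mk.injEq] at h
    exact ⟨by omega, fun _ => rfl⟩
  · rw [cycleNode_inner h1 hi, cycleNode, dif_pos (by omega)] at h
    exact (Sum.inr_ne_inl h).elim
  · rw [cycleNode_inner h2 hi', cycleNode, dif_pos (by omega)] at h
    exact (Sum.inl_ne_inr h).elim
  · rw [cycleNode, dif_pos (by omega), cycleNode, dif_pos (by omega)] at h
    simp only [Sum.inl.injEq, Fin.mk.injEq] at h
    exact ⟨h, fun h' => by omega⟩

end cycleNode

section compact

variable {V K : Type} [Finite V] [Finite K] (trunk : List (V × V)) (petal : K → List (V × V))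

/-- The state reached after `i` letters of the cycle made of the trunk and the petal `k`, as a state
of the transducer. -/
def node (k : K) (i : ℕ) : (compactTransducer trunk petal).State :=
  cycleNode (a := trunk.length) (l := fun k => (petal k).length) k i

/-- The first main state. -/
def mainState : (compactTransducer trunk petal).State :=
  (Sum.inl 0 : CompactState trunk.length (fun k => (petal k).length))

/-- `t` is the `i`-th transition of the cycle made of the trunk and the petal `k`. -/
def CycleTile (k : K) (i : ℕ) (t : Tile (compactTransducer trunk petal).State V) : Prop :=
  t.w = node trunk petal k i ∧ t.e = node trunk petal k (i + 1) ∧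
    (trunk ++ petal k)[i]? = some (t.s, t.n)

variable {trunk petal}

theorem node_zero (k : K) : node trunk petal k 0 = mainState trunk petal := cycleNode_zero

theorem node_end {k : K} (hl : 2 ≤ (petal k).length) :
    node trunk petal k (trunk.length + (petal k).length) = mainState trunk petal :=
  cycleNode_end (l := fun k => (petal k).length) hl

theorem node_trunk {k k' : K} {i : ℕ} (h : i ≤ trunk.length) :
    node trunk petal k i = node trunk petal k' i := cycleNode_trunk h

theorem node_inj {k k' : K} {i i' : ℕ} (hi : i < trunk.length + (petal k).length)
    (hi' : i' < trunk.length + (petal k').length)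
    (h : node trunk petal k i = node trunk petal k' i') :
    i = i' ∧ (trunk.length < i → k = k') :=
  cycleNode_inj (l := fun k => (petal k).length) hi hi' h

theorem node_of_le {k : K} {i : ℕ} (h : i < trunk.length + 1) :
    node trunk petal k i =
      (Sum.inl ⟨i, h⟩ : CompactState trunk.length (fun k => (petal k).length)) := dif_pos h

theorem node_petal (k : K) (j : ℕ) : node trunk petal k (trunk.length + j) =
    (petalNode k j : CompactState trunk.length (fun k => (petal k).length)) := by
  unfold node cycleNode
  split_ifs with h
  · obtain rfl : j = 0 := by omega
    rfl
  · congr 1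
    omega

theorem CycleTile.lt {k : K} {i : ℕ} {t : Tile (compactTransducer trunk petal).State V}
    (h : CycleTile trunk petal k i t) : i < trunk.length + (petal k).length := by
  obtain ⟨h, -⟩ := List.getElem?_eq_some_iff.1 h.2.2
  simpa using h

theorem mem_tiles_iff [Nonempty K]
    {t : Tile (compactTransducer trunk petal).State V} :
    t ∈ (compactTransducer trunk petal).tiles ↔ ∃ k i, CycleTile trunk petal k i t := by
  constructor
  · rintro (⟨i, rfl⟩ | ⟨k, j, rfl⟩)
    · obtain ⟨k⟩ := ‹Nonempty K›
      refine ⟨k, i, (node_of_le (by omega)).symm, (node_of_le (by omega)).symm, ?_⟩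
      rw [List.getElem?_append_left i.2]
      simp
    · refine ⟨k, trunk.length + j, (node_petal k j).symm, (node_petal k (j + 1)).symm, ?_⟩
      simp
  · rintro ⟨k, i, h⟩
    have hlt := h.lt
    obtain ⟨h1, h2, h3⟩ := h
    obtain ⟨w, e, s, n⟩ := t
    dsimp only at h1 h2 h3
    subst h1 h2
    rcases lt_or_ge i trunk.length with hi | hi
    · refine .inl ⟨⟨i, hi⟩, ?_⟩
      rw [List.getElem?_append_left hi] at h3
      obtain ⟨_, h3⟩ := List.getElem?_eq_some_iff.1 h3
      rw [node_of_le (by omega), node_of_le (by omega), List.get_eq_getElem, h3]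
      rfl
    · obtain ⟨j, rfl⟩ : ∃ j, i = trunk.length + j := ⟨i - trunk.length, by omega⟩
      refine .inr ⟨k, ⟨j, by omega⟩, ?_⟩
      rw [List.getElem?_append_right hi, Nat.add_sub_cancel_left] at h3
      obtain ⟨_, h3⟩ := List.getElem?_eq_some_iff.1 h3
      rw [add_assoc, node_petal, node_petal, List.get_eq_getElem, h3]
      rfl

/-- The runs of a transducer in compact form are the decompositions of `ℤ` into cycles. -/
theorem compactTransducer_rel_iff [Nonempty K] (hl : ∀ k, 2 ≤ (petal k).length) {w w' : ℤ → V} :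
    (compactTransducer trunk petal).Rel w w' ↔ ∃ S : ℤ → K → Prop,
      (∀ z, ∃ x k, S x k ∧ x ≤ z ∧ z < x + (trunk ++ petal k).length) ∧
      (∀ x k y j, S x k → S y j → x ≤ y → y < x + (trunk ++ petal k).length → x = y ∧ k = j) ∧
      (∀ x k, S x k → ∀ i < (trunk ++ petal k).length,
        (trunk ++ petal k)[i]? = some (w (x + i), w' (x + i))) := by
  constructor
  · rintro ⟨f, hf, he, hs, hn⟩
    have hf' := fun x => (mem_tiles_iff).1 (hf x)
    choose κ ι h using hf'
    set a := trunk.length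
    have walk : ∀ z k i, i < a + (petal k).length → (f z).w = node trunk petal k i →
        ι z = i ∧ (a < i → κ z = k) := by
      intro z k i hi hz
      have := node_inj hi (h z).lt (hz.symm.trans (h z).1)
      exact ⟨this.1.symm, fun h => (this.2 h).symm⟩
    have step : ∀ z, (f (z + 1)).w = node trunk petal (κ z) (ι z + 1) := fun z =>
      (he z).symm.trans (h z).2.1
    have back : ∀ (i : ℕ) z, ι z = i → ι (z - i) = 0 := by
      intro i
      induction i with
      | zero => simp
      | succ i ih =>
        intro z hz
        have h1 := step (z - 1)
        rw [sub_add_cancel] at h1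
        have h2 : ι (z - 1) = i := by
          by_cases hlt : ι (z - 1) + 1 < a + (petal (κ (z - 1))).length
          · have := (walk _ _ _ hlt h1).1
            omega
          · have hend : ι (z - 1) + 1 = a + (petal (κ (z - 1))).length := by
              have : _ < a + _ := (h (z - 1)).lt
              omega
            rw [hend, node_end (hl _)] at h1
            have := (walk z (κ z) 0 (by have := hl (κ z); omega)
              (h1.trans (node_zero _).symm)).1
            omega
        have := ih _ h2
        convert this using 2
        push_cast
        ring
    have forth : ∀ x, ι x = 0 → ∃ k, (∀ i < a + (petal k).length,
        CycleTile trunk petal k i (f (x + i))) ∧ ι (x + (a + (petal k).length : ℕ)) = 0 := by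
      intro x hx
      have low : ∀ i : ℕ, i ≤ a → ι (x + i) = i := by
        intro i
        induction i with
        | zero => simpa using hx
        | succ i ih =>
          intro hi
          have h1 := step (x + i)
          rw [ih (by omega)] at h1
          have hlt := hl (κ (x + i))
          have := (walk _ _ _ (by omega) h1).1
          rwa [add_assoc, ← Nat.cast_succ] at this
      -- On the trunk the chosen `κ` is arbitrary; at `x + a` the run takes the first transition of
      -- a petal.
      refine ⟨κ (x + a), ?_⟩
      set k := κ (x + a) with hk
      have high : ∀ j : ℕ, j < (petal k).length →
          ι (x + (a + j : ℕ)) = a + j ∧ κ (x + (a + j : ℕ)) = k := by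
        intro j
        induction j with
        | zero => exact fun _ => ⟨low a le_rfl, rfl⟩
        | succ j ih =>
          intro hj
          have h1 := step (x + (a + j : ℕ))
          rw [(ih (by omega)).1, (ih (by omega)).2] at h1
          have := walk _ _ _ (by omega) h1
          have e : x + (a + j : ℕ) + 1 = x + (a + (j + 1) : ℕ) := by push_cast; ring
          rw [e] at this
          exact ⟨by omega, this.2 (by omega)⟩
      refine ⟨fun i hi => ?_, ?_⟩
      · rcases lt_or_ge i a with hia | hia
        · have h1 := h (x + i)
          rw [low i hia.le] at h1
          refine ⟨h1.1.trans (node_trunk hia.le), h1.2.1.trans (node_trunk hia), ?_⟩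
          have h2 := h1.2.2
          rwa [List.getElem?_append_left hia] at h2 ⊢
        · obtain ⟨j, rfl⟩ : ∃ j, i = a + j := ⟨i - a, by omega⟩
          have h1 := h (x + (a + j : ℕ))
          rwa [(high j (by omega)).1, (high j (by omega)).2] at h1
      · have h2 := hl k
        have h1 := step (x + (a + ((petal k).length - 1) : ℕ))
        rw [(high _ (by omega)).1, (high _ (by omega)).2] at h1
        have e1 : a + ((petal k).length - 1) + 1 = a + (petal k).length := by omega
        have e2 : x + (a + ((petal k).length - 1) : ℕ) + 1 = x + (a + (petal k).length : ℕ) := by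
          omega
        rw [e1, e2, node_end h2] at h1
        exact (walk _ k 0 (by omega) (h1.trans (node_zero _).symm)).1
    refine ⟨fun x k => ∀ i < a + (petal k).length, CycleTile trunk petal k i (f (x + i)),
      fun z => ?_, fun x k y j hx hy h1 h2 => ?_, fun x k hx i hi => ?_⟩
    · obtain ⟨x, ⟨hx, hx0⟩, hmax⟩ := Int.exists_greatest_of_bdd (P := fun x => x ≤ z ∧ ι x = 0)
        ⟨z, fun x h => h.1⟩ ⟨z - ι z, by omega, back _ z rfl⟩
      obtain ⟨k, hk, hend⟩ := forth x hx0
      refine ⟨x, k, hk, hx, ?_⟩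
      by_contra hz
      rw [List.length_append] at hz
      have := hmax _ ⟨by omega, hend⟩
      have := hl k
      omega
    · rw [List.length_append] at h2
      obtain ⟨i, rfl⟩ : ∃ i : ℕ, y = x + i := ⟨(y - x).toNat, by omega⟩
      have hj := hl j
      have h3 := (hx i (by omega)).1.symm.trans (by simpa using (hy 0 (by omega)).1)
      obtain ⟨rfl, -⟩ := node_inj (by omega) (by omega) h3
      refine ⟨by simp, ?_⟩
      have hk := hl k
      -- Petals have length at least 2, so the state after the first letter of a petal is an inner
      -- state, which identifies the petal.
      have h4 := (hx (a + 1) (by omega)).1.symm.trans (by simpa using (hy (a + 1) (by omega)).1)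
      exact (node_inj (by omega) (by omega) h4).2 (by omega)
    · rw [List.length_append] at hi
      rw [(hx i hi).2.2, hs, hn]
  · rintro ⟨S, hcover, hsep, hlab⟩
    choose p k hS hle hlt using hcover
    have same : ∀ z x j, S x j → x ≤ z → z < x + (trunk ++ petal j).length → p z = x ∧ k z = j := by
      intro z x j hx h1 h2
      rcases le_total (p z) x with h | h
      · exact hsep _ _ _ _ (hS z) hx h (by have := hlt z; omega)
      · exact (hsep _ _ _ _ hx (hS z) h (by have := hle z; omega)).imp Eq.symm Eq.symm
    refine ⟨fun z => ⟨node trunk petal (k z) (z - p z).toNat,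
      node trunk petal (k z) ((z - p z).toNat + 1), w z, w' z⟩, fun z => ?_,
      fun z => ?_, fun _ => rfl, fun _ => rfl⟩
    · refine (mem_tiles_iff).2 ⟨k z, (z - p z).toNat, rfl, rfl, ?_⟩
      have h1 := hle z
      have h2 := hlt z
      have := hlab _ _ (hS z) (z - p z).toNat (by omega)
      rwa [show p z + ((z - p z).toNat : ℤ) = z by omega] at this
    · dsimp only
      have h1 := hle z
      have h2 := hlt z
      by_cases h3 : z + 1 < p z + (trunk ++ petal (k z)).length
      · obtain ⟨e1, e2⟩ := same (z + 1) _ _ (hS z) (by omega) h3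
        rw [e1, e2]
        congr 1
        omega
      · have h4 : p (z + 1) = z + 1 := by
          by_contra hne
          have h5 := hle (z + 1)
          have h6 := hlt (z + 1)
          obtain ⟨e1, e2⟩ := same z _ _ (hS (z + 1)) (by omega) (by omega)
          rw [e1, e2] at h3
          omega
        rw [h4, sub_self, Int.toNat_zero, node_zero]
        rw [List.length_append] at h2 h3
        rw [show (z - p z).toNat + 1 = trunk.length + (petal (k z)).length by omega,
          node_end (hl _)]

end compact

/-! ### The transducers `T_n` in terms of marks -/

theorem fibG_add_two (n : ℕ) : fibG (n + 2) = fibG n + fibG (n + 1) := rfl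

theorem fibG_pos (n : ℕ) : 0 < fibG n := by
  induction n using Nat.strong_induction_on with
  | _ n ih =>
    match n with
    | 0 => decide
    | 1 => decide
    | n + 2 =>
      have := ih n (by omega)
      rw [fibG_add_two]
      omega

theorem fibG_bounds (n : ℕ) : 8 * fibG (n + 2) ≤ 5 * fibG (n + 3) ∧
    3 * fibG (n + 3) ≤ 5 * fibG (n + 2) := by
  induction n using Nat.strong_induction_on with
  | _ n ih =>
    match n with
    | 0 => decide
    | 1 => decide
    | n + 2 =>
      have h1 := ih n (by omega)
      have h2 := fibG_add_two (n + 2)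
      have h3 := fibG_add_two (n + 3)
      simp only [Nat.add_assoc, Nat.reduceAdd] at h1 h2 h3 ⊢
      omega

theorem le_fibG (n : ℕ) : n + 3 ≤ fibG (n + 2) := by
  induction n with
  | zero => decide
  | succ n ih =>
    have h := fibG_add_two (n + 1)
    have := fibG_pos (n + 1)
    simp only [Nat.add_assoc, Nat.reduceAdd] at h ⊢
    omega

/-- The word `w` has the marks `P`, `Q`, in the form read by `T_n`. -/
def IsWord (n : ℕ) (P Q : ℤ → Prop) (w : ℤ → Fin 2) : Prop :=
  if Even n then ∀ y, w y = 1 ↔ loWord P Q y else ∀ y, w y = 0 ↔ hiWord P Q y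

/-- Positions, within a cycle, of the letters of the block `110` or `111` read there. -/
def loIn (b c t : ℤ) : Fin 5 → Prop :=
  ![False, False, c - 3 ≤ t ∧ t ≤ c - 1, c - 3 ≤ t ∧ t ≤ c - 2, b + c - 3 ≤ t ∧ t ≤ b + c - 2]
/-- Positions, within a cycle, of the letters of the block `100` or `000` read there. -/
def hiIn (b c t : ℤ) : Fin 5 → Prop :=
  ![False, False, c - 3 ≤ t ∧ t ≤ c - 1, c - 2 ≤ t ∧ t ≤ c - 1, b + c - 2 ≤ t ∧ t ≤ b + c - 1]
/-- Positions, within a cycle, of the letters of the block `110` or `111` written there. -/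
def loOut (b c t : ℤ) : Fin 5 → Prop :=
  ![b - 3 ≤ t ∧ t ≤ b - 2, 2 * b - 3 ≤ t ∧ t ≤ 2 * b - 1, False, False, c - 3 ≤ t ∧ t ≤ c - 2]
/-- Positions, within a cycle, of the letters of the block `100` or `000` written there. -/
def hiOut (b c t : ℤ) : Fin 5 → Prop :=
  ![b - 2 ≤ t ∧ t ≤ b - 1, 2 * b - 3 ≤ t ∧ t ≤ 2 * b - 1, False, False, c - 2 ≤ t ∧ t ≤ c - 1]

section words

variable {b c y : ℤ} {S : ℤ → Fin 5 → Prop}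

theorem exists_fin5 {R : Fin 5 → Prop} : (∃ k, R k) ↔ R 0 ∨ R 1 ∨ R 2 ∨ R 3 ∨ R 4 := by
  constructor
  · rintro ⟨k, h⟩
    fin_cases k <;> simp_all
  · rintro (h | h | h | h | h) <;> exact ⟨_, h⟩

theorem exists_two {R : ℤ → Prop} {t u : ℤ} (h : u = t + 1) :
    (∃ p, R p ∧ t ≤ y - p ∧ y - p ≤ u) ↔ R (y - u) ∨ R (y - t) := by
  subst h
  constructor
  · rintro ⟨p, hp, h⟩
    rcases (show p = y - (t + 1) ∨ p = y - t by omega) with rfl | rfl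
    · exact .inl hp
    · exact .inr hp
  · rintro (h | h) <;> exact ⟨_, h, by omega, by omega⟩

theorem exists_three {R : ℤ → Prop} {t u : ℤ} (h : u = t + 2) :
    (∃ p, R p ∧ t ≤ y - p ∧ y - p ≤ u) ↔ R (y - u) ∨ R (y - t - 1) ∨ R (y - t) := by
  subst h
  constructor
  · rintro ⟨p, hp, h⟩
    rcases (show p = y - (t + 2) ∨ p = y - t - 1 ∨ p = y - t by omega) with rfl | rfl | rfl
    · exact .inl hp
    · exact .inr (.inl hp)
    · exact .inr (.inr hp)
  · rintro (h | h | h) <;> exact ⟨_, h, by omega, by omega⟩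

theorem loWord_in_iff :
    loWord (inS b c S) (inL c S) y ↔ ∃ k p, S p k ∧ loIn b c (y - p) k := by
  rw [exists_fin5]
  change _ ↔ (∃ p, S p 0 ∧ False) ∨
      (∃ p, S p 1 ∧ False) ∨
      (∃ p, S p 2 ∧ c - 3 ≤ y - p ∧ y - p ≤ c - 1) ∨
      (∃ p, S p 3 ∧ c - 3 ≤ y - p ∧ y - p ≤ c - 2) ∨
      (∃ p, S p 4 ∧ b + c - 3 ≤ y - p ∧ y - p ≤ b + c - 2)
  rw [exists_three (R := fun p => S p 2) (t := c - 3) (u := c - 1) (by ring),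
    exists_two (R := fun p => S p 3) (t := c - 3) (u := c - 2) (by ring),
    exists_two (R := fun p => S p 4) (t := b + c - 3) (u := b + c - 2) (by ring)]
  simp only [loWord, inS, inL, and_false, exists_false, false_or]
  ring_nf
  tauto

theorem hiWord_in_iff :
    hiWord (inS b c S) (inL c S) y ↔ ∃ k p, S p k ∧ hiIn b c (y - p) k := by
  rw [exists_fin5]
  change _ ↔ (∃ p, S p 0 ∧ False) ∨
      (∃ p, S p 1 ∧ False) ∨
      (∃ p, S p 2 ∧ c - 3 ≤ y - p ∧ y - p ≤ c - 1) ∨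
      (∃ p, S p 3 ∧ c - 2 ≤ y - p ∧ y - p ≤ c - 1) ∨
      (∃ p, S p 4 ∧ b + c - 2 ≤ y - p ∧ y - p ≤ b + c - 1)
  rw [exists_three (R := fun p => S p 2) (t := c - 3) (u := c - 1) (by ring),
    exists_two (R := fun p => S p 3) (t := c - 2) (u := c - 1) (by ring),
    exists_two (R := fun p => S p 4) (t := b + c - 2) (u := b + c - 1) (by ring)]
  simp only [hiWord, inS, inL, and_false, exists_false, false_or]
  ring_nf
  tauto

theorem loWord_out_iff :
    loWord (outS b c S) (outL b S) y ↔ ∃ k p, S p k ∧ loOut b c (y - p) k := by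
  rw [exists_fin5]
  change _ ↔ (∃ p, S p 0 ∧ b - 3 ≤ y - p ∧ y - p ≤ b - 2) ∨
      (∃ p, S p 1 ∧ 2 * b - 3 ≤ y - p ∧ y - p ≤ 2 * b - 1) ∨
      (∃ p, S p 2 ∧ False) ∨
      (∃ p, S p 3 ∧ False) ∨
      (∃ p, S p 4 ∧ c - 3 ≤ y - p ∧ y - p ≤ c - 2)
  rw [exists_two (R := fun p => S p 0) (t := b - 3) (u := b - 2) (by ring),
    exists_three (R := fun p => S p 1) (t := 2 * b - 3) (u := 2 * b - 1) (by ring),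
    exists_two (R := fun p => S p 4) (t := c - 3) (u := c - 2) (by ring)]
  simp only [loWord, outS, outL, and_false, exists_false, false_or]
  ring_nf
  tauto

theorem hiWord_out_iff :
    hiWord (outS b c S) (outL b S) y ↔ ∃ k p, S p k ∧ hiOut b c (y - p) k := by
  rw [exists_fin5]
  change _ ↔ (∃ p, S p 0 ∧ b - 2 ≤ y - p ∧ y - p ≤ b - 1) ∨
      (∃ p, S p 1 ∧ 2 * b - 3 ≤ y - p ∧ y - p ≤ 2 * b - 1) ∨
      (∃ p, S p 2 ∧ False) ∨
      (∃ p, S p 3 ∧ False) ∨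
      (∃ p, S p 4 ∧ c - 2 ≤ y - p ∧ y - p ≤ c - 1)
  rw [exists_two (R := fun p => S p 0) (t := b - 2) (u := b - 1) (by ring),
    exists_three (R := fun p => S p 1) (t := 2 * b - 3) (u := 2 * b - 1) (by ring),
    exists_two (R := fun p => S p 4) (t := c - 2) (u := c - 1) (by ring)]
  simp only [hiWord, outS, outL, and_false, exists_false, false_or]
  ring_nf
  tauto

/-- A property of positions within cycles, at a position of a known cycle. -/
theorem IsParse.exists_iff (hS : IsParse b c S) {R : ℤ → Fin 5 → Prop}
    (hR : ∀ t k, R t k → 0 ≤ t ∧ t < cyc b c k) {x : ℤ} {k : Fin 5} (hx : S x k) {t : ℤ}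
    (h0 : 0 ≤ t) (ht : t < cyc b c k) : (∃ k p, S p k ∧ R (x + t - p) k) ↔ R t k := by
  constructor
  · rintro ⟨j, p, hp, hr⟩
    have := hR _ _ hr
    obtain ⟨rfl, rfl⟩ := hS.clash hx hp (by omega) (by omega)
    simpa using hr
  · intro h
    exact ⟨k, x, hx, by simpa using h⟩

theorem block_bounds (h3 : 3 ≤ b) (hbc : b < c) (t : ℤ) (k : Fin 5) :
    (loIn b c t k ∨ hiIn b c t k ∨ loOut b c t k ∨ hiOut b c t k) → 0 ≤ t ∧ t < cyc b c k := by
  fin_cases k <;> simp [loIn, hiIn, loOut, hiOut, cyc] <;> omega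

end words

/-- The trunk has length `fibG (n + 2) - 3`, so a block written right after it ends at offset b; the
other offsets of marks arise in the same way. With blocks rewritten as powers, each letter is found
by comparing lengths. -/
theorem trunk_append_petal_getElem (n : ℕ) (k : Fin 5) (i : ℕ)
    (hi : (i : ℤ) < cyc (fibG (n + 2)) (fibG (n + 3)) k) :
    (∃ v, (trunkIn n ++ petalIn n k)[i]? = some v ∧
      if Even n then v = 1 ↔ loIn (fibG (n + 2)) (fibG (n + 3)) i k
      else v = 0 ↔ hiIn (fibG (n + 2)) (fibG (n + 3)) i k) ∧
    (∃ v, (trunkOut n ++ petalOut n k)[i]? = some v ∧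
      if Even n then v = 0 ↔ hiOut (fibG (n + 2)) (fibG (n + 3)) i k
      else v = 1 ↔ loOut (fibG (n + 2)) (fibG (n + 3)) i k) := by
  have hb := le_fibG n
  have ha := fibG_pos (n + 1)
  have hc : fibG (n + 3) = fibG (n + 1) + fibG (n + 2) := rfl
  have e1 : ∀ u : Fin 2, [u, u, u] = rep u 3 := fun u => rfl
  have e2 : ([1, 1, 0] : List (Fin 2)) = rep 1 2 ++ rep 0 1 := rfl
  have e3 : ([1, 0, 0] : List (Fin 2)) = rep 1 1 ++ rep 0 2 := rfl
  generalize hA : fibG (n + 1) = A at *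
  generalize hB : fibG (n + 2) = B at *
  generalize hC : fibG (n + 3) = C at *
  have hk : k = 0 ∨ k = 1 ∨ k = 2 ∨ k = 3 ∨ k = 4 := by omega
  have hi' : (i : ℤ) < 2 * C ∧ (k = 0 → (i : ℤ) < C) ∧ (k = 1 → (i : ℤ) < B + C) ∧
      (k = 2 → (i : ℤ) < B + C) ∧ (k = 3 → (i : ℤ) < C) := by
    rcases hk with rfl | rfl | rfl | rfl | rfl <;>
      simp only [cyc_0, cyc_1, cyc_2, cyc_3, cyc_4] at hi <;> omega
  by_cases hn : Even n
  · constructor <;> rcases hk with rfl | rfl | rfl | rfl | rfl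
    all_goals
      clear hi
      simp only [trunkIn, petalIn, trunkOut, petalOut, if_pos hn, loIn, hiOut, Matrix.cons_val,
        hA, hB, hC, e1, e2, e3, List.getElem?_append, List.getElem?_replicate, List.length_append,
        List.length_replicate]
      split_ifs <;> first
        | exact ⟨_, rfl, iff_of_true rfl (by omega)⟩
        | exact ⟨_, rfl, iff_of_false (by decide) (by omega)⟩
        | exact ⟨_, rfl, iff_of_false (by decide) id⟩
        | (exfalso; omega)
  · constructor <;> rcases hk with rfl | rfl | rfl | rfl | rfl
    all_goals
      clear hi
      simp only [trunkIn, petalIn, trunkOut, petalOut, if_neg hn, hiIn, loOut, Matrix.cons_val,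
        hA, hB, hC, e1, e2, e3, List.getElem?_append, List.getElem?_replicate, List.length_append,
        List.length_replicate]
      split_ifs <;> first
        | exact ⟨_, rfl, iff_of_true rfl (by omega)⟩
        | exact ⟨_, rfl, iff_of_false (by decide) (by omega)⟩
        | exact ⟨_, rfl, iff_of_false (by decide) id⟩
        | (exfalso; omega)

theorem Fin.eq_of_one_iff {u v : Fin 2} (h : u = 1 ↔ v = 1) : u = v := by omega

theorem Fin.eq_of_zero_iff {u v : Fin 2} (h : u = 0 ↔ v = 0) : u = v := by omega

/-- The label of a cycle agrees with the words described by the marks. -/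
theorem label_iff (n : ℕ) {S : ℤ → Fin 5 → Prop} (hS : IsParse (fibG (n + 2)) (fibG (n + 3)) S)
    {w w' : ℤ → Fin 2} {x : ℤ} {k : Fin 5} (hx : S x k) {i : ℕ}
    (hi : (i : ℤ) < cyc (fibG (n + 2)) (fibG (n + 3)) k) :
    ((trunkIn n).zip (trunkOut n) ++ (petalIn n k).zip (petalOut n k))[i]? =
        some (w (x + i), w' (x + i)) ↔
      (if Even n then w (x + i) = 1 ↔
          loWord (inS (fibG (n + 2)) (fibG (n + 3)) S) (inL (fibG (n + 3)) S) (x + i)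
        else w (x + i) = 0 ↔
          hiWord (inS (fibG (n + 2)) (fibG (n + 3)) S) (inL (fibG (n + 3)) S) (x + i)) ∧
      (if Even n then w' (x + i) = 0 ↔
          hiWord (outS (fibG (n + 2)) (fibG (n + 3)) S) (outL (fibG (n + 2)) S) (x + i)
        else w' (x + i) = 1 ↔
          loWord (outS (fibG (n + 2)) (fibG (n + 3)) S) (outL (fibG (n + 2)) S) (x + i)) := by
  have h3 : (3 : ℤ) ≤ fibG (n + 2) := by have := le_fibG n; omega
  have hbc : (fibG (n + 2) : ℤ) < fibG (n + 3) := by have := fibG_bounds n; omega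
  obtain ⟨⟨v, hv, hvi⟩, ⟨v', hv', hvi'⟩⟩ := trunk_append_petal_getElem n k i hi
  rw [← List.zip_append (label_length n).1, List.getElem?_zip_eq_some, hv, hv']
  simp only [Option.some.injEq]
  have bd := fun t j => block_bounds h3 hbc t j
  have e1 := hS.exists_iff (fun t j h => bd t j (.inl h)) hx (Int.natCast_nonneg i) hi
  have e2 := hS.exists_iff (fun t j h => bd t j (.inr (.inl h))) hx (Int.natCast_nonneg i) hi
  have e3 := hS.exists_iff (fun t j h => bd t j (.inr (.inr (.inl h)))) hx (Int.natCast_nonneg i) hi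
  have e4 := hS.exists_iff (fun t j h => bd t j (.inr (.inr (.inr h)))) hx (Int.natCast_nonneg i) hi
  rw [loWord_in_iff, hiWord_in_iff, loWord_out_iff, hiWord_out_iff, e1, e2, e3, e4]
  by_cases hn : Even n
  · simp only [if_pos hn] at hvi hvi' ⊢
    rw [← hvi, ← hvi']
    exact ⟨fun h => by rw [h.1, h.2]; exact ⟨.rfl, .rfl⟩,
      fun h => ⟨(Fin.eq_of_one_iff h.1).symm, (Fin.eq_of_zero_iff h.2).symm⟩⟩
  · simp only [if_neg hn] at hvi hvi' ⊢
    rw [← hvi, ← hvi']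
    exact ⟨fun h => by rw [h.1, h.2]; exact ⟨.rfl, .rfl⟩,
      fun h => ⟨(Fin.eq_of_zero_iff h.1).symm, (Fin.eq_of_one_iff h.2).symm⟩⟩

theorem length_label (n : ℕ) (k : Fin 5) :
    (((trunkIn n).zip (trunkOut n) ++ (petalIn n k).zip (petalOut n k)).length : ℤ) =
      cyc (fibG (n + 2)) (fibG (n + 3)) k := by
  have h := label_length n
  have hb := le_fibG n
  have hc : fibG (n + 3) = fibG (n + 1) + fibG (n + 2) := rfl
  rw [List.length_append, List.length_zip, List.length_zip, ← h.1, ← h.2 k, min_self, min_self]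
  by_cases hn : Even n <;> fin_cases k <;> simp [trunkIn, petalIn, hn, cyc] <;> omega

/-- The relation of `T_n`, in terms of marks. -/
theorem transT_rel_iff (n : ℕ) (w w' : ℤ → Fin 2) :
    (transT n).Rel w w' ↔ ∃ S, IsParse (fibG (n + 2)) (fibG (n + 3)) S ∧
      IsWord n (inS (fibG (n + 2)) (fibG (n + 3)) S) (inL (fibG (n + 3)) S) w ∧
      IsWord (n + 1) (outS (fibG (n + 2)) (fibG (n + 3)) S) (outL (fibG (n + 2)) S) w' := by
  have hb := le_fibG n
  have hbc := fibG_bounds n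
  have hl : ∀ k : Fin 5, 2 ≤ ((petalIn n k).zip (petalOut n k)).length := by
    intro k
    rw [List.length_zip, ← (label_length n).2 k, min_self]
    by_cases hn : Even n <;> fin_cases k <;> simp [petalIn, hn] <;> omega
  rw [transT, compactTransducer_rel_iff hl]
  refine exists_congr fun S => ?_
  simp only [length_label]
  constructor
  · rintro ⟨hc, hs, hlab⟩
    have hS : IsParse (fibG (n + 2)) (fibG (n + 3)) S := ⟨by omega, by omega, hc, hs⟩
    refine ⟨hS, ?_⟩
    have key : ∀ y,
      (if Even n then w y = 1 ↔
          loWord (inS (fibG (n + 2)) (fibG (n + 3)) S) (inL (fibG (n + 3)) S) y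
        else w y = 0 ↔
          hiWord (inS (fibG (n + 2)) (fibG (n + 3)) S) (inL (fibG (n + 3)) S) y) ∧
      (if Even n then w' y = 0 ↔
          hiWord (outS (fibG (n + 2)) (fibG (n + 3)) S) (outL (fibG (n + 2)) S) y
        else w' y = 1 ↔
          loWord (outS (fibG (n + 2)) (fibG (n + 3)) S) (outL (fibG (n + 2)) S) y) := by
      intro y
      obtain ⟨x, k, hx, h1, h2⟩ := hc y
      obtain ⟨i, rfl⟩ : ∃ i : ℕ, y = x + i := ⟨(y - x).toNat, by omega⟩
      have hi : (i : ℤ) < cyc (fibG (n + 2)) (fibG (n + 3)) k := by omega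
      exact (label_iff n hS hx hi).1 (hlab x k hx i (by have := length_label n k; omega))
    by_cases hn : Even n
    · simp only [IsWord, Nat.even_add_one, hn, not_true, if_true, if_false] at key ⊢
      exact ⟨fun y => (key y).1, fun y => (key y).2⟩
    · simp only [IsWord, Nat.even_add_one, hn, not_false_eq_true, if_true, if_false] at key ⊢
      exact ⟨fun y => (key y).1, fun y => (key y).2⟩
  · rintro ⟨hS, hw, hw'⟩
    refine ⟨hS.cover, hS.sep, fun x k hx i hi => ?_⟩
    have := length_label n k
    refine (label_iff n hS hx (by omega)).2 ?_
    by_cases hn : Even n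
    · simp only [IsWord, Nat.even_add_one, hn, not_true, if_true, if_false] at hw hw' ⊢
      exact ⟨hw _, hw' _⟩
    · simp only [IsWord, Nat.even_add_one, hn, not_false_eq_true, if_true, if_false] at hw hw' ⊢
      exact ⟨hw _, hw' _⟩

/-! ### Composing, splitting and excluding stacks of `T_n` -/

/-- `S` is a parse of a row of `T_n` that reads `w` and writes `w'`. -/
def RowParse (n : ℕ) (S : ℤ → Fin 5 → Prop) (w w' : ℤ → Fin 2) : Prop :=
  IsParse (fibG (n + 2)) (fibG (n + 3)) S ∧
    IsWord n (inS (fibG (n + 2)) (fibG (n + 3)) S) (inL (fibG (n + 3)) S) w ∧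
    IsWord (n + 1) (outS (fibG (n + 2)) (fibG (n + 3)) S) (outL (fibG (n + 2)) S) w'

theorem fibG_cast_bounds (n : ℕ) : (3 : ℤ) ≤ fibG (n + 2) ∧ (5 : ℤ) ≤ fibG (n + 3) ∧
    8 * (fibG (n + 2) : ℤ) ≤ 5 * fibG (n + 3) ∧ 3 * (fibG (n + 3) : ℤ) ≤ 5 * fibG (n + 2) ∧
    (fibG (n + 4) : ℤ) = fibG (n + 2) + fibG (n + 3) := by
  have h1 := fibG_bounds n
  have h2 := le_fibG n
  have h3 : fibG (n + 4) = fibG (n + 2) + fibG (n + 3) := rfl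
  omega

theorem isWord_add_two {n : ℕ} {P Q : ℤ → Prop} {w : ℤ → Fin 2} :
    IsWord (n + 2) P Q w ↔ IsWord n P Q w := by
  simp [IsWord, Nat.even_add]

/-- This turns the equality of the word between two rows into an `Interface`. -/
theorem IsWord.marks_eq {n : ℕ} {P Q P' Q' : ℤ → Prop} {w : ℤ → Fin 2} (h : IsWord n P Q w)
    (h' : IsWord n P' Q' w) (hs : Spaced P Q) (hs' : Spaced P' Q') :
    (∀ y, P y ↔ P' y) ∧ ∀ y, Q y ↔ Q' y := by
  unfold IsWord at h h'
  split_ifs at h h'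
  · exact hs.eq_of_loWord hs' fun y => (h y).symm.trans (h' y)
  · exact hs.eq_of_hiWord hs' fun y => (h y).symm.trans (h' y)

theorem isWord_congr {n : ℕ} {P Q P' Q' : ℤ → Prop} {w : ℤ → Fin 2} (hP : ∀ y, P y ↔ P' y)
    (hQ : ∀ y, Q y ↔ Q' y) : IsWord n P Q w ↔ IsWord n P' Q' w := by
  rw [funext fun y => propext (hP y), funext fun y => propext (hQ y)]

theorem exists_isWord (n : ℕ) (P Q : ℤ → Prop) : ∃ w, IsWord n P Q w := by
  classical
  by_cases hn : Even n
  · exact ⟨fun y => if loWord P Q y then 1 else 0, by simp [IsWord, hn]⟩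
  · exact ⟨fun y => if hiWord P Q y then 0 else 1, by simp [IsWord, hn]⟩

theorem RowParse.spaced_in {n : ℕ} {S : ℤ → Fin 5 → Prop} {w w' : ℤ → Fin 2}
    (h : RowParse n S w w') :
    Spaced (inS (fibG (n + 2)) (fibG (n + 3)) S) (inL (fibG (n + 3)) S) := by
  have := fibG_cast_bounds n
  exact h.1.spaced_in (by omega) (by omega)

theorem RowParse.spaced_out {n : ℕ} {S : ℤ → Fin 5 → Prop} {w w' : ℤ → Fin 2}
    (h : RowParse n S w w') :
    Spaced (outS (fibG (n + 2)) (fibG (n + 3)) S) (outL (fibG (n + 2)) S) := by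
  have := fibG_cast_bounds n
  exact h.1.spaced_out (by omega) (by omega) (by omega)

theorem fin_two_eq_one_iff {u : Fin 2} : u = 1 ↔ ¬ u = 0 := by omega

/-- Consecutive rows have transducers of opposite parities. -/
theorem even_iff_not_even_of_rel {m m' : ℕ} {u v w : ℤ → Fin 2} (h : (transT m).Rel u v)
    (h' : (transT m').Rel v w) : Even m ↔ ¬ Even m' := by
  obtain ⟨S, hS⟩ := (transT_rel_iff _ _ _).1 h
  obtain ⟨S', hS'⟩ := (transT_rel_iff _ _ _).1 h'
  change RowParse m S u v at hS
  change RowParse m' S' v w at hS'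
  have b := fibG_cast_bounds m
  have b' := fibG_cast_bounds m'
  have hout := hS.2.2
  have hin := hS'.2.1
  by_contra hne
  by_cases hm : Even m
  · have hm' : Even m' := by tauto
    simp only [IsWord, Nat.even_add_one, hm, hm', not_true, if_true, if_false] at hout hin
    refine hS'.spaced_in.lo_ne_hi hS.spaced_out (fun x y hx hy hxy => ?_)
      (fun x y hx hy hxy => ?_) fun y => by rw [← hin, ← hout, fin_two_eq_one_iff]
    · have := hS'.1.in_gap_long (by omega) hx hy hxy
      omega
    · have := hS.1.out_gap_long (by omega) (by omega) hx hy hxy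
      omega
  · have hm' : ¬ Even m' := by tauto
    simp only [IsWord, Nat.even_add_one, hm, hm', not_false_eq_true, if_true, if_false] at hout hin
    -- The gap lemmas used in this case give only c. An odd index is at least 1, which makes c at
    -- least 8.
    have big : ∀ k, ¬ Even k → (8 : ℤ) ≤ fibG (k + 3) := by
      intro k hk
      obtain ⟨j, rfl⟩ : ∃ j, k = j + 1 := ⟨k - 1, by
        have h1 : k ≠ 0 := by rintro rfl; simp at hk
        omega⟩
      have := fibG_cast_bounds j
      simp only [Nat.add_assoc, Nat.reduceAdd]
      omega
    have c8 := big m hm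
    have c8' := big m' hm'
    refine hS.spaced_out.lo_ne_hi hS'.spaced_in (fun x y hx hy hxy => ?_)
      (fun x y hx hy hxy => ?_) fun y => by rw [← hin, ← hout, fin_two_eq_one_iff]
    · have := hS.1.out_gap (by omega) (by omega) (.inr hx) hy hxy
      omega
    · have := hS'.1.in_gap (by omega) hx (.inr hy) hxy
      omega

section rows

variable {n : ℕ} {U T V : ℤ → Fin 5 → Prop} {w₀ w₁ w₂ w₃ : ℤ → Fin 2}

theorem RowParse.sandwich (hU : RowParse (n + 1) U w₀ w₁) (hT : RowParse n T w₁ w₂)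
    (hV : RowParse (n + 1) V w₂ w₃) : Sandwich (fibG (n + 2)) (fibG (n + 3)) U T V := by
  have b := fibG_cast_bounds n
  have hUT := (isWord_add_two.1 hU.2.2).marks_eq hT.2.1 hU.spaced_out hT.spaced_in
  have hTV := hT.2.2.marks_eq hV.2.1 hT.spaced_out hV.spaced_in
  have hU1 := hU.1
  have hV1 := hV.1
  have e : (fibG (n + 1 + 3) : ℤ) = fibG (n + 2) + fibG (n + 3) := b.2.2.2.2
  rw [e] at hUT hTV hU1 hV1
  exact ⟨b.2.2.1, b.2.2.2.1, hU1, hT.1, hV1, ⟨hUT.1, hUT.2⟩, ⟨hTV.1, hTV.2⟩⟩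

theorem RowParse.comp (hU : RowParse (n + 1) U w₀ w₁) (hT : RowParse n T w₁ w₂)
    (hV : RowParse (n + 1) V w₂ w₃) :
    RowParse (n + 3) (merge (fibG (n + 2)) (fibG (n + 3)) T) w₀ w₃ := by
  have s := hU.sandwich hT hV
  have b := fibG_cast_bounds n
  have b' := fibG_cast_bounds (n + 1)
  have b'' := fibG_cast_bounds (n + 2)
  have e0 : (fibG (n + 1 + 3) : ℤ) = fibG (n + 2) + fibG (n + 3) := b.2.2.2.2
  have e1 : (fibG (n + 3 + 2) : ℤ) = fibG (n + 2) + 2 * fibG (n + 3) := by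
    simp only [Nat.add_assoc, Nat.reduceAdd] at *
    omega
  have e2 : (fibG (n + 3 + 3) : ℤ) = 2 * fibG (n + 2) + 3 * fibG (n + 3) := by
    simp only [Nat.add_assoc, Nat.reduceAdd] at *
    omega
  have hin := hU.2.1
  have hout := isWord_add_two.1 hV.2.2
  rw [e0, s.first_eq] at hin
  rw [e0, s.last_eq] at hout
  refine ⟨by rw [e1, e2]; exact s.isParse_merge, isWord_add_two.2 ?_,
    isWord_add_two.2 (isWord_add_two.2 ?_)⟩ <;> rw [e1, e2]
  · exact (isWord_congr (inS_firstRow _ _ _) (inL_firstRow _ _ _)).1 hin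
  · exact (isWord_congr (outS_lastRow _ _ _) (outL_lastRow _ _ _)).1 hout

end rows

/-- `T_{n+1} ∘ T_n ∘ T_{n+1}` is contained in `T_{n+3}`. -/
theorem transT_rel_comp {n : ℕ} {w₀ w₁ w₂ w₃ : ℤ → Fin 2} (h₀ : (transT (n + 1)).Rel w₀ w₁)
    (h₁ : (transT n).Rel w₁ w₂) (h₂ : (transT (n + 1)).Rel w₂ w₃) :
    (transT (n + 3)).Rel w₀ w₃ := by
  obtain ⟨U, hU⟩ := (transT_rel_iff _ _ _).1 h₀
  obtain ⟨T, hT⟩ := (transT_rel_iff _ _ _).1 h₁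
  obtain ⟨V, hV⟩ := (transT_rel_iff _ _ _).1 h₂
  exact (transT_rel_iff _ _ _).2 ⟨_, RowParse.comp hU hT hV⟩

/-- `T_{n+3}` is contained in `T_{n+1} ∘ T_n ∘ T_{n+1}`. -/
theorem transT_rel_split {n : ℕ} {w₀ w₃ : ℤ → Fin 2} (h : (transT (n + 3)).Rel w₀ w₃) :
    ∃ w₁ w₂, (transT (n + 1)).Rel w₀ w₁ ∧ (transT n).Rel w₁ w₂ ∧ (transT (n + 1)).Rel w₂ w₃ := by
  obtain ⟨W, hW, hin, hout⟩ := (transT_rel_iff _ _ _).1 h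
  have b := fibG_cast_bounds n
  have b' := fibG_cast_bounds (n + 1)
  have b'' := fibG_cast_bounds (n + 2)
  have e0 : (fibG (n + 1 + 3) : ℤ) = fibG (n + 2) + fibG (n + 3) := b.2.2.2.2
  have e1 : (fibG (n + 3 + 2) : ℤ) = fibG (n + 2) + 2 * fibG (n + 3) := by
    simp only [Nat.add_assoc, Nat.reduceAdd] at *
    omega
  have e2 : (fibG (n + 3 + 3) : ℤ) = 2 * fibG (n + 2) + 3 * fibG (n + 3) := by
    simp only [Nat.add_assoc, Nat.reduceAdd] at *
    omega
  have hin := isWord_add_two.1 hin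
  have hout := isWord_add_two.1 (isWord_add_two.1 hout)
  rw [e1, e2] at hW hin hout
  have hUT := interface_first_middle (fibG (n + 2)) (fibG (n + 3)) W
  have hTV := interface_middle_last (fibG (n + 2)) (fibG (n + 3)) W
  have hU := hW.refine (b := fibG (n + 3)) (c := fibG (n + 2) + fibG (n + 3)) (by omega) (by omega)
    (tiles_firstRow _ _)
  have hT := hW.refine (b := fibG (n + 2)) (c := fibG (n + 3)) (by omega) (by omega)
    (tiles_middleRow _ _)
  have hV := hW.refine (b := fibG (n + 3)) (c := fibG (n + 2) + fibG (n + 3)) (by omega) (by omega)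
    (tiles_lastRow _ _)
  have hin := (isWord_congr (inS_firstRow _ _ W) (inL_firstRow _ _ W)).2 hin
  have hout := (isWord_congr (outS_lastRow _ _ W) (outL_lastRow _ _ W)).2 hout
  set U := refine (firstRow (fibG (n + 2)) (fibG (n + 3))) W
  set T := refine (middleRow (fibG (n + 2)) (fibG (n + 3))) W
  set V := refine (lastRow (fibG (n + 2)) (fibG (n + 3))) W
  obtain ⟨w₁, h₁⟩ := exists_isWord n (inS (fibG (n + 2)) (fibG (n + 3)) T) (inL (fibG (n + 3)) T)
  obtain ⟨w₂, h₂⟩ := exists_isWord (n + 1) (outS (fibG (n + 2)) (fibG (n + 3)) T)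
    (outL (fibG (n + 2)) T)
  refine ⟨w₁, w₂, (transT_rel_iff _ _ _).2 ⟨U, ?_, ?_, ?_⟩, (transT_rel_iff _ _ _).2 ⟨T, hT, h₁, h₂⟩,
    (transT_rel_iff _ _ _).2 ⟨V, ?_, ?_, ?_⟩⟩ <;> rw [e0]
  · exact hU
  · exact hin
  · exact isWord_add_two.2 ((isWord_congr hUT.short hUT.long).2 h₁)
  · exact hV
  · exact (isWord_congr hTV.short hTV.long).1 h₂
  · exact isWord_add_two.2 hout

/-- The composition `T_{n+1} ∘ T_n ∘ T_{n+1} ∘ T_n ∘ T_{n+1}` is empty. -/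
theorem transT_no_chain {n : ℕ} {w₀ w₁ w₂ w₃ w₄ w₅ : ℤ → Fin 2}
    (h₀ : (transT (n + 1)).Rel w₀ w₁) (h₁ : (transT n).Rel w₁ w₂)
    (h₂ : (transT (n + 1)).Rel w₂ w₃) (h₃ : (transT n).Rel w₃ w₄)
    (h₄ : (transT (n + 1)).Rel w₄ w₅) : False := by
  obtain ⟨U, hU⟩ := (transT_rel_iff _ _ _).1 h₀
  obtain ⟨T, hT⟩ := (transT_rel_iff _ _ _).1 h₁
  obtain ⟨V, hV⟩ := (transT_rel_iff _ _ _).1 h₂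
  obtain ⟨T', hT'⟩ := (transT_rel_iff _ _ _).1 h₃
  obtain ⟨V', hV'⟩ := (transT_rel_iff _ _ _).1 h₄
  exact (RowParse.sandwich hU hT hV).no_chain (RowParse.sandwich hV hT' hV')

/-! ### Replacing blocks, and descent on the period -/

/-- A set of integers unbounded in both directions is enumerated increasingly by the integers. -/
theorem exists_strictMono_enumeration {C : ℤ → Prop} (above : ∀ z, ∃ x, z ≤ x ∧ C x)
    (below : ∀ z, ∃ x, x ≤ z ∧ C x) : ∃ c : ℤ → ℤ, StrictMono c ∧ ∀ z, C z ↔ ∃ j, c j = z := by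
  classical
  let : LocallyFiniteOrder {z // C z} := Subtype.instLocallyFiniteOrder _
  have : Nonempty {z // C z} := ⟨⟨_, (above 0).choose_spec.2⟩⟩
  have : NoMaxOrder {z // C z} := ⟨fun a => by
    obtain ⟨x, h1, h2⟩ := above (a + 1)
    exact ⟨⟨x, h2⟩, Subtype.mk_lt_mk.2 (show (a : ℤ) < x by omega)⟩⟩
  have : NoMinOrder {z // C z} := ⟨fun a => by
    obtain ⟨x, h1, h2⟩ := below (a - 1)
    exact ⟨⟨x, h2⟩, Subtype.mk_lt_mk.2 (show x < (a : ℤ) by omega)⟩⟩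
  let : SuccOrder {z // C z} := LinearLocallyFiniteOrder.succOrder _
  let : PredOrder {z // C z} := LinearLocallyFiniteOrder.predOrder _
  let e : ℤ ≃o {z // C z} := orderIsoIntOfLinearSuccPredArch.symm
  refine ⟨fun j => e j, fun i j h => e.strictMono h, fun z => ⟨fun hz => ⟨e.symm ⟨z, hz⟩, by simp⟩, ?_⟩⟩
  rintro ⟨j, rfl⟩
  exact (e j).2

theorem add_le_of_strictMono {c : ℤ → ℤ} (hc : StrictMono c) (j : ℤ) (k : ℕ) :
    c j + k ≤ c (j + k) := by
  induction k with
  | zero => simp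
  | succ k ih =>
    have := hc (show j + k < j + (k + 1 : ℕ) by push_cast; omega)
    push_cast at this ⊢
    omega

/-- All the indices of the sequence `s` are among `n`, `n + 1`, `n + 2`. -/
def IsLevel (n : ℕ) (s : ℤ → ℕ) : Prop := ∀ i, s i = n ∨ s i = n + 1 ∨ s i = n + 2

section stacking

variable {n : ℕ} {s : ℤ → ℕ} {w : ℤ → ℤ → Fin 2}

/-- Among the three possible indices, only n + 1 has the parity opposite to that of n. -/
theorem IsStacking.alternate (hw : IsStacking s w) (hs : IsLevel n s) (i : ℤ) :
    s i = n + 1 ↔ s (i + 1) ≠ n + 1 := by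
  have h := even_iff_not_even_of_rel (hw i) (hw (i + 1))
  have key : ∀ j, s j = n + 1 ↔ (Even (s j) ↔ ¬ Even n) := by
    intro j
    rcases hs j with h | h | h <;> simp only [h, Nat.even_add_one] <;> grind
  rw [key, Ne, key]
  tauto

theorem IsStacking.sides (hw : IsStacking s w) (hs : IsLevel n s) {i : ℤ} (h : s i = n) :
    s (i - 1) = n + 1 ∧ s (i + 1) = n + 1 := by
  have h1 := hw.alternate hs (i - 1)
  have h2 := hw.alternate hs i
  rw [sub_add_cancel] at h1
  constructor
  · exact h1.2 (by omega)
  · by_contra h3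
    have := h2.2 h3
    omega

theorem IsStacking.no_chain (hw : IsStacking s w) {i : ℤ} (h0 : s i = n + 1)
    (h1 : s (i + 1) = n) (h2 : s (i + 2) = n + 1) (h3 : s (i + 3) = n)
    (h4 : s (i + 4) = n + 1) : False := by
  have r0 := hw i
  have r1 := hw (i + 1)
  have r2 := hw (i + 2)
  have r3 := hw (i + 3)
  have r4 := hw (i + 4)
  rw [h0] at r0
  rw [h1] at r1
  rw [h2] at r2
  rw [h3] at r3
  rw [h4] at r4
  simp only [add_assoc, Int.reduceAdd] at r1 r2 r3 r4
  exact transT_no_chain r0 r1 r2 r3 r4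

theorem IsStacking.isolated (hw : IsStacking s w) (hs : IsLevel n s) {i : ℤ} (h : s i = n) :
    s (i + 2) ≠ n := by
  intro h'
  have h1 := hw.sides hs h
  have h2 := hw.sides hs h'
  refine hw.no_chain (n := n) (i := i - 1) h1.1 ?_ ?_ ?_ ?_
  · rwa [sub_add_cancel]
  · convert h1.2 using 2
    ring
  · convert h' using 2
    ring
  · convert h2.2 using 2
    ring

/-- Without n, the indices n + 1 and n + 2 would alternate and form a chain excluded at level n + 1.
-/
theorem IsStacking.exists_lowest (hw : IsStacking s w) (hs : IsLevel n s) : ∃ i, s i = n := by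
  by_contra hne
  push Not at hne
  have high : ∀ i, s i = n + 1 ∨ s i = n + 2 := fun i => (hs i).resolve_left (hne i)
  have next : ∀ i, s i = n + 2 → s (i + 1) = n + 1 := fun i h => by
    have := hw.alternate hs i
    by_contra h'
    have := this.2 h'
    omega
  have next' : ∀ i, s i = n + 1 → s (i + 1) = n + 2 := fun i h => by
    have := (hw.alternate hs i).1 h
    exact (high _).resolve_left this
  obtain ⟨i, hi⟩ : ∃ i, s i = n + 2 := by
    rcases high 0 with h | h
    · exact ⟨_, next' _ h⟩
    · exact ⟨_, h⟩
  have h1 := next _ hi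
  have h2 := next' _ h1
  have h3 := next _ h2
  have h4 := next' _ h3
  simp only [add_assoc, Int.reduceAdd] at h2 h3 h4
  exact hw.no_chain (n := n + 1) hi h1 h2 h3 h4

theorem IsStacking.blockAt_iff (hw : IsStacking s w) (hs : IsLevel n s) (i : ℤ) :
    BlockAt n s i ↔ s (i + 1) = n := by
  refine ⟨fun h => h.2.1, fun h => ?_⟩
  have := hw.sides hs h
  simp only [add_sub_cancel_right, add_assoc, Int.reduceAdd] at this
  exact ⟨this.1, h, this.2⟩

/-- Replacing every block `T_{n+1} ∘ T_n ∘ T_{n+1}` by `T_{n+3}`. -/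
theorem IsStacking.exists_replacement (hw : IsStacking s w) (hs : IsLevel n s) :
    ∃ (c : ℤ → ℤ) (s' : ℤ → ℕ), StrictMono c ∧
      (∀ z, (s z ≠ n ∧ s (z - 1) ≠ n) ↔ ∃ j, c j = z) ∧
      (∀ j, (c (j + 1) = c j + 1 ∧ s' j = s (c j) ∧ s (c j + 1) ≠ n) ∨
        (c (j + 1) = c j + 3 ∧ s' j = n + 3 ∧ s (c j + 1) = n)) ∧
      IsLevel (n + 1) s' ∧ IsStacking s' (fun j => w (c j)) := by
  classical
  -- The indices kept are the z with neither s z nor s (z - 1) equal to n: of each block only the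
  -- first index remains. Since the indices of `T_n` are isolated, one of any three consecutive
  -- indices is kept.
  have start : ∀ z, (s z ≠ n ∧ s (z - 1) ≠ n) ∨ (s (z + 1) ≠ n ∧ s z ≠ n) ∨
      (s (z + 2) ≠ n ∧ s (z + 1) ≠ n) := by
    intro z
    by_cases h0 : s z = n
    · have h1 := (hw.sides hs h0).2
      have h2 := hw.isolated hs h0
      exact .inr (.inr ⟨h2, by omega⟩)
    · by_cases h1 : s (z + 1) = n
      · left
        refine ⟨h0, fun h => hw.isolated hs h ?_⟩
        convert h1 using 2
        ring
      · exact .inr (.inl ⟨h1, h0⟩)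
  have above : ∀ z, ∃ x, z ≤ x ∧ (s x ≠ n ∧ s (x - 1) ≠ n) := by
    intro z
    rcases start z with h | h | h
    · exact ⟨z, le_rfl, h⟩
    · exact ⟨z + 1, by omega, by simpa using h⟩
    · refine ⟨z + 2, by omega, h.1, ?_⟩
      convert h.2 using 2
      ring_nf
  have below : ∀ z, ∃ x, x ≤ z ∧ (s x ≠ n ∧ s (x - 1) ≠ n) := by
    intro z
    rcases start (z - 2) with h | h | h
    · exact ⟨z - 2, by omega, h⟩
    · exact ⟨z - 2 + 1, by omega, by simpa using h⟩
    · refine ⟨z - 2 + 2, by omega, h.1, ?_⟩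
      convert h.2 using 2
      ring_nf
  obtain ⟨c, hc, hC⟩ := exists_strictMono_enumeration above below
  have mem : ∀ j, s (c j) ≠ n ∧ s (c j - 1) ≠ n := fun j => (hC _).2 ⟨j, rfl⟩
  have least : ∀ j z, (s z ≠ n ∧ s (z - 1) ≠ n) → c j < z → c (j + 1) ≤ z := by
    intro j z hz hlt
    obtain ⟨i, rfl⟩ := (hC z).1 hz
    exact hc.monotone (hc.lt_iff_lt.1 hlt)
  have lt : ∀ j, c j < c (j + 1) := fun j => hc (by omega)
  have step : ∀ j, (c (j + 1) = c j + 1 ∧ s (c j + 1) ≠ n) ∨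
      (c (j + 1) = c j + 3 ∧ s (c j + 1) = n) := by
    intro j
    have hlt := lt j
    have hj := mem j
    have hj' := mem (j + 1)
    by_cases h : s (c j + 1) = n
    · right
      refine ⟨?_, h⟩
      have h1 := (hw.sides hs h).2
      have h2 := hw.isolated hs h
      have hle := least j (c j + 3) ⟨by convert h2 using 2; ring_nf, by
        rw [show c j + 3 - 1 = c j + 1 + 1 by ring, h1]; omega⟩ (by omega)
      rcases (show c (j + 1) = c j + 1 ∨ c (j + 1) = c j + 2 ∨ c (j + 1) = c j + 3 by omega)
        with e | e | e
      · rw [e] at hj'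
        exact (hj'.1 h).elim
      · rw [e, show c j + 2 - 1 = c j + 1 by ring] at hj'
        exact (hj'.2 h).elim
      · exact e
    · left
      have := least j (c j + 1) ⟨h, by rw [add_sub_cancel_right]; exact hj.1⟩ (by omega)
      exact ⟨by omega, h⟩
  refine ⟨c, fun j => if s (c j + 1) = n then n + 3 else s (c j), hc, hC, fun j => ?_, fun j => ?_,
    fun j => ?_⟩
  · rcases step j with ⟨h1, h2⟩ | ⟨h1, h2⟩
    · exact .inl ⟨h1, if_neg h2, h2⟩
    · exact .inr ⟨h1, if_pos h2, h2⟩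
  · dsimp only
    split_ifs
    · omega
    · have h1 := (mem j).1
      have h2 := hs (c j)
      omega
  · dsimp only
    rcases step j with ⟨h1, h2⟩ | ⟨h1, h2⟩
    · rw [if_neg h2, h1]
      exact hw (c j)
    · rw [if_pos h2, h1]
      obtain ⟨b0, b1, b2⟩ := (hw.blockAt_iff hs (c j)).2 h2
      have r0 := hw (c j)
      have r1 := hw (c j + 1)
      have r2 := hw (c j + 2)
      rw [b0] at r0
      rw [b1] at r1
      rw [b2] at r2
      simp only [add_assoc, Int.reduceAdd] at r1 r2
      exact transT_rel_comp r0 r1 r2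

/-- No stacking has a periodic sequence of transducers. -/
theorem IsStacking.not_periodic (v : ℕ) (hv : 0 < v) : ∀ (n : ℕ) (s : ℤ → ℕ) (w : ℤ → ℤ → Fin 2),
    IsLevel n s → IsStacking s w → (∀ i, s (i + v) = s i) → False := by
  induction v using Nat.strong_induction_on with
  | _ v ih =>
    intro n s w hs hw hper
    obtain ⟨c, s', hc, hC, step, hs', hw'⟩ := hw.exists_replacement hs
    -- The kept indices are invariant under translation by v, which therefore acts on their
    -- numbering as a translation by some m > 0; then m is a period of `s'`.
    have shift : ∀ j, ∃ i, c i = c j + v := by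
      intro j
      have h := (hC (c j)).2 ⟨j, rfl⟩
      refine (hC _).1 ⟨by rw [hper]; exact h.1, ?_⟩
      rw [show c j + v - 1 = c j - 1 + v by ring, hper]
      exact h.2
    choose σ hσ using shift
    have hsucc : ∀ j, σ (j + 1) = σ j + 1 := by
      intro j
      apply hc.injective
      have e : s (c (σ j) + 1) = s (c j + 1) := by
        rw [hσ, show c j + v + 1 = c j + 1 + v by ring, hper]
      have h1 := step j
      have h2 := step (σ j)
      have h3 := hσ (j + 1)
      have h4 := hσ j
      rw [e] at h2
      rcases h1 with ⟨h1, -, h1'⟩ | ⟨h1, -, h1'⟩ <;> rcases h2 with ⟨h2, -, h2'⟩ | ⟨h2, -, h2'⟩ <;> omega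
    have htrans : ∀ j, σ j = j + σ 0 := by
      intro j
      induction j using Int.induction_on with
      | zero => simp
      | succ j ih =>
        rw [hsucc, ih]
        ring
      | pred j ih =>
        have := hsucc (-j - 1)
        rw [sub_add_cancel] at this
        omega
    have hm : 0 < σ 0 := hc.lt_iff_lt.1 (by rw [hσ]; omega)
    obtain ⟨m, hm'⟩ : ∃ m : ℕ, σ 0 = m := ⟨(σ 0).toNat, by omega⟩
    rw [hm'] at hm htrans
    obtain ⟨i, hi⟩ := hw.exists_lowest hs
    obtain ⟨j, hj⟩ := (hC (i - 1)).1 ⟨by have := hw.sides hs hi; omega, fun h => by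
      refine hw.isolated hs h ?_
      convert hi using 2
      ring⟩
    -- One step of `c` across a block advances by 3, and all steps advance by at least 1, so m < v.
    have hj3 : c (j + 1) = c j + 3 := by
      rcases step j with ⟨-, -, h⟩ | ⟨h, -⟩
      · rw [hj, sub_add_cancel] at h
        exact (h hi).elim
      · exact h
    have hle := add_le_of_strictMono hc (j + 1) (m - 1)
    have hend := hσ j
    rw [htrans, show j + (m : ℤ) = j + 1 + (m - 1 : ℕ) by omega] at hend
    refine ih m (by omega) (by omega) (n + 1) s' _ hs' hw' fun j => ?_
    have h4 := hσ j
    rw [htrans] at h4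
    have e : s (c (j + m) + 1) = s (c j + 1) := by
      rw [h4, show c j + v + 1 = c j + 1 + v by ring, hper]
    have e' : s (c (j + m)) = s (c j) := by rw [h4, hper]
    have h1 := step j
    have h2 := step (j + m)
    rw [e, e'] at h2
    rcases h1 with ⟨-, h1, h1'⟩ | ⟨-, h1, h1'⟩ <;> rcases h2 with ⟨-, h2, h2'⟩ | ⟨-, h2, h2'⟩ <;> omega

/-- Replacement only drops rows, so a horizontal period persists while the level increases. -/
theorem IsStacking.lift (hw : IsStacking s w) (hs : IsLevel n s) {u : ℤ}
    (hu : ∀ i x, w i (x + u) = w i x) (k : ℕ) :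
    ∃ s' w', IsLevel (n + k) s' ∧ IsStacking s' w' ∧ ∀ i x, w' i (x + u) = w' i x := by
  induction k with
  | zero => exact ⟨s, w, hs, hw, hu⟩
  | succ k ih =>
    obtain ⟨s', w', hs', hw', hu'⟩ := ih
    obtain ⟨c, s'', -, -, -, hs'', hw''⟩ := hw'.exists_replacement hs'
    exact ⟨s'', _, hs'', hw'', fun i x => hu' _ x⟩

end stacking

/-! ### Horizontal periods, and runs of `T_n` -/

theorem IsWord.shift {n : ℕ} {P Q : ℤ → Prop} {w : ℤ → Fin 2} (h : IsWord n P Q w) {u : ℤ}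
    (hu : ∀ x, w (x + u) = w x) : IsWord n (fun y => P (y + u)) (fun y => Q (y + u)) w := by
  unfold IsWord at h ⊢
  split_ifs at h ⊢ <;> intro y <;> rw [← hu, h] <;>
    simp only [loWord, hiWord, add_right_comm y u]

theorem Spaced.shift {P Q : ℤ → Prop} (h : Spaced P Q) (u : ℤ) :
    Spaced (fun y => P (y + u)) (fun y => Q (y + u)) :=
  ⟨fun y => h.disjoint _, fun x y hx hy hxy => by
    have := h.gap _ _ hx hy (by omega)
    omega⟩

/-- A row of `T_n` does not read and write words with a common small period. -/
theorem not_rel_of_periodic {n u : ℕ} (hu : 0 < u) (hun : u ≤ n) {w w' : ℤ → Fin 2}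
    (hw : ∀ x, w (x + u) = w x) (hw' : ∀ x, w' (x + u) = w' x) : ¬ (transT n).Rel w w' := by
  intro h
  obtain ⟨S, hS⟩ := (transT_rel_iff _ _ _).1 h
  change RowParse n S w w' at hS
  have b := fibG_cast_bounds n
  have hn := le_fibG n
  have hin := hS.2.1.marks_eq (hS.2.1.shift hw) hS.spaced_in (hS.spaced_in.shift u)
  have hout := hS.2.2.marks_eq (hS.2.2.shift hw') hS.spaced_out (hS.spaced_out.shift u)
  -- A mark translated by u is again a mark, but u ≤ n < c while marks are at least c apart.
  have no_in : ∀ y, ¬ (inS (fibG (n + 2)) (fibG (n + 3)) S y ∨ inL (fibG (n + 3)) S y) := by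
    intro y hy
    have := hS.1.in_gap (by omega) hy (hy.imp (hin.1 y).1 (hin.2 y).1) (by omega)
    omega
  have no_out : ∀ y, ¬ (outS (fibG (n + 2)) (fibG (n + 3)) S y ∨ outL (fibG (n + 2)) S y) := by
    intro y hy
    have := hS.1.out_gap (by omega) (by omega) hy (hy.imp (hout.1 y).1 (hout.2 y).1) (by omega)
    omega
  -- Every kind of cycle reads or writes a mark.
  obtain ⟨x, k, hx, -⟩ := hS.1.cover 0
  fin_cases k
  · exact no_out (x + fibG (n + 2)) (.inl (.inl (start_at hx)))
  · exact no_out (x + 2 * fibG (n + 2)) (.inr (start_at hx))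
  · exact no_in (x + fibG (n + 3)) (.inr (start_at hx))
  · exact no_in (x + fibG (n + 3)) (.inl (.inl (start_at hx)))
  · exact no_out (x + fibG (n + 3)) (.inl (.inr (start_at hx)))

/-- Every `T_n` has a run. -/
theorem exists_transT_rel (n : ℕ) : ∃ w w', (transT n).Rel w w' := by
  have b := fibG_cast_bounds n
  let S : ℤ → Fin 5 → Prop := fun x k => k = 0 ∧ (fibG (n + 3) : ℤ) ∣ x
  have hS : IsParse (fibG (n + 2)) (fibG (n + 3)) S := by
    refine ⟨by omega, by omega, fun z => ?_, ?_⟩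
    · refine ⟨fibG (n + 3) * (z / fibG (n + 3)), 0, ⟨rfl, dvd_mul_right _ _⟩,
        Int.mul_ediv_self_le (by omega), ?_⟩
      rw [cyc_0]
      have := Int.lt_mul_ediv_self_add (x := z) (k := fibG (n + 3)) (by omega)
      omega
    · rintro x k y j ⟨rfl, hx⟩ ⟨rfl, hy⟩ h1 h2
      rw [cyc_0] at h2
      refine ⟨?_, rfl⟩
      have := Int.eq_zero_of_dvd_of_nonneg_of_lt (by omega) (by omega) (dvd_sub hy hx)
      omega
  obtain ⟨w, hw⟩ := exists_isWord n (inS (fibG (n + 2)) (fibG (n + 3)) S) (inL (fibG (n + 3)) S)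
  obtain ⟨w', hw'⟩ := exists_isWord (n + 1) (outS (fibG (n + 2)) (fibG (n + 3)) S)
    (outL (fibG (n + 2)) S)
  exact ⟨w, w', (transT_rel_iff _ _ _).2 ⟨S, hS, hw, hw'⟩⟩

/-! ### Tilings by `T_0 ∪ T_1 ∪ T_2` -/

section union

variable {V : Type} {A B : WangSet V}

/-- A row of a union is a row of one of the two Wang sets. -/
theorem union_row {f : ℤ → Tile (A.union B).State V} (hf : ∀ x, f x ∈ (A.union B).tiles)
    (he : ∀ x, (f x).e = (f (x + 1)).w) :
    (∃ g : ℤ → Tile A.State V, (∀ x, g x ∈ A.tiles) ∧ (∀ x, (g x).e = (g (x + 1)).w) ∧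
      ∀ x, f x = ⟨Sum.inl (g x).w, Sum.inl (g x).e, (g x).s, (g x).n⟩) ∨
    (∃ g : ℤ → Tile B.State V, (∀ x, g x ∈ B.tiles) ∧ (∀ x, (g x).e = (g (x + 1)).w) ∧
      ∀ x, f x = ⟨Sum.inr (g x).w, Sum.inr (g x).e, (g x).s, (g x).n⟩) := by
  let left : Tile (A.union B).State V → Prop :=
    fun t => ∃ a ∈ A.tiles, t = ⟨Sum.inl a.w, Sum.inl a.e, a.s, a.n⟩
  let right : Tile (A.union B).State V → Prop :=
    fun t => ∃ b ∈ B.tiles, t = ⟨Sum.inr b.w, Sum.inr b.e, b.s, b.n⟩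
  have hLR : ∀ x, left (f x) ∨ right (f x) := hf
  have step : ∀ x, left (f x) ↔ left (f (x + 1)) := by
    intro x
    have h := he x
    rcases hLR x with ⟨a, ha, h1⟩ | ⟨a, ha, h1⟩ <;> rcases hLR (x + 1) with ⟨b, hb, h2⟩ | ⟨b, hb, h2⟩
    · exact ⟨fun _ => ⟨b, hb, h2⟩, fun _ => ⟨a, ha, h1⟩⟩
    · rw [h1, h2] at h
      exact (Sum.inl_ne_inr h).elim
    · rw [h1, h2] at h
      exact (Sum.inr_ne_inl h).elim
    · refine iff_of_false ?_ ?_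
      · rintro ⟨a', -, h1'⟩
        exact Sum.inl_ne_inr (congrArg Tile.w (h1'.symm.trans h1))
      · rintro ⟨a', -, h1'⟩
        exact Sum.inl_ne_inr (congrArg Tile.w (h1'.symm.trans h2))
  have const : ∀ x, left (f x) ↔ left (f 0) := by
    intro x
    induction x using Int.induction_on with
    | zero => rfl
    | succ j ih => rw [← step, ih]
    | pred j ih =>
      have := step (-j - 1)
      rw [sub_add_cancel] at this
      rw [this, ih]
  by_cases h0 : left (f 0)
  · left
    choose g hg hfg using fun x => (const x).2 h0
    refine ⟨g, hg, fun x => ?_, hfg⟩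
    have h := he x
    rw [hfg, hfg] at h
    exact Sum.inl_injective h
  · right
    choose g hg hfg using fun x => (hLR x).resolve_left fun h => h0 ((const x).1 h)
    refine ⟨g, hg, fun x => ?_, hfg⟩
    have h := he x
    rw [hfg, hfg] at h
    exact Sum.inr_injective h

theorem union_rel_left {w w' : ℤ → V} (h : A.Rel w w') : (A.union B).Rel w w' := by
  obtain ⟨f, h1, h2, h3, h4⟩ := h
  exact ⟨fun x => ⟨Sum.inl (f x).w, Sum.inl (f x).e, (f x).s, (f x).n⟩,
    fun x => .inl ⟨f x, h1 x, rfl⟩, fun x => congrArg Sum.inl (h2 x), h3, h4⟩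

theorem union_rel_right {w w' : ℤ → V} (h : B.Rel w w') : (A.union B).Rel w w' := by
  obtain ⟨f, h1, h2, h3, h4⟩ := h
  exact ⟨fun x => ⟨Sum.inr (f x).w, Sum.inr (f x).e, (f x).s, (f x).n⟩,
    fun x => .inr ⟨f x, h1 x, rfl⟩, fun x => congrArg Sum.inr (h2 x), h3, h4⟩

end union

/-- The Wang set `T_0 ∪ T_1 ∪ T_2`. -/
abbrev unionT : WangSet (Fin 2) := ((transT 0).union (transT 1)).union (transT 2)

/-- The index of the transducer to which a state of `T_0 ∪ T_1 ∪ T_2` belongs. -/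
def unionIndex : unionT.State → ℕ := Sum.elim (Sum.elim (fun _ => 0) fun _ => 1) fun _ => 2

theorem unionIndex_lt (q : unionT.State) :
    unionIndex q = 0 ∨ unionIndex q = 1 ∨ unionIndex q = 2 := by
  rcases q with (q | q) | q
  · exact .inl rfl
  · exact .inr (.inl rfl)
  · exact .inr (.inr rfl)

/-- A row of `T_0 ∪ T_1 ∪ T_2` is a row of one of the three transducers. -/
theorem unionT_row {f : ℤ → Tile unionT.State (Fin 2)} (hf : ∀ x, f x ∈ unionT.tiles)
    (he : ∀ x, (f x).e = (f (x + 1)).w) : ∃ m, (∀ x, unionIndex (f x).w = m) ∧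
      (transT m).Rel (fun x => (f x).s) (fun x => (f x).n) := by
  rcases union_row hf he with ⟨g, hg, hge, hfg⟩ | ⟨g, hg, hge, hfg⟩
  · rcases union_row hg hge with ⟨k, hk, hke, hgk⟩ | ⟨k, hk, hke, hgk⟩
    · exact ⟨0, fun x => by rw [hfg, hgk]; rfl, k, hk, hke, fun x => by simp only [hfg, hgk],
        fun x => by simp only [hfg, hgk]⟩
    · exact ⟨1, fun x => by rw [hfg, hgk]; rfl, k, hk, hke, fun x => by simp only [hfg, hgk],
        fun x => by simp only [hfg, hgk]⟩
  · exact ⟨2, fun x => by rw [hfg]; rfl, g, hg, hge, fun x => by simp only [hfg],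
      fun x => by simp only [hfg]⟩

/-- A tiling by `T_0 ∪ T_1 ∪ T_2` is a stacking of rows. -/
theorem isStacking_of_isTiling {f : ℤ → ℤ → Tile unionT.State (Fin 2)} (hf : unionT.IsTiling f) :
    (∀ x y, unionIndex (f x y).w = unionIndex (f 0 y).w) ∧
      IsLevel 0 (fun y => unionIndex (f 0 y).w) ∧
      IsStacking (fun y => unionIndex (f 0 y).w) (fun y x => (f x y).s) := by
  obtain ⟨h1, h2, h3⟩ := hf
  have row := fun y => unionT_row (fun x => h1 x y) (fun x => h2 x y)
  refine ⟨fun x y => ?_, fun y => unionIndex_lt _, fun y => ?_⟩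
  · obtain ⟨m, hm, -⟩ := row y
    rw [hm, hm]
  · obtain ⟨m, hm, hrel⟩ := row y
    dsimp only
    rw [hm, ← funext fun x => h3 x y]
    exact hrel

/-- The index is constant along a row, so a period (u, v) with v nonzero gives the sequence of
indices the period v, whatever u is. If v = 0, lifting by |u| levels reaches transducers with index
at least |u|. -/
theorem unionT_not_periodic (f : ℤ → ℤ → Tile unionT.State (Fin 2)) (hf : unionT.IsTiling f) :
    ¬ WangSet.IsPeriodicTiling f := by
  obtain ⟨hrow, hlevel, hstack⟩ := isStacking_of_isTiling hf
  rintro ⟨u, v, huv, hper⟩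
  by_cases hv : v = 0
  · subst hv
    have hu : u ≠ 0 := fun h => huv (by rw [h])
    simp only [add_zero] at hper
    have hper' : ∀ x y, (f (x + u.natAbs) y).s = (f x y).s := by
      intro x y
      rcases Int.natAbs_eq u with h | h
      · rw [← h, ← hper]
      · rw [hper, show x + u.natAbs + u = x by omega]
    obtain ⟨s, w, hs, hw, hwu⟩ := hstack.lift hlevel (fun y x => hper' x y) u.natAbs
    have hle : u.natAbs ≤ s 0 := by
      have := hs 0
      omega
    exact not_rel_of_periodic (by omega) hle (hwu 0) (hwu (0 + 1)) (hw 0)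
  · have hsv : ∀ y, unionIndex (f 0 (y + v)).w = unionIndex (f 0 y).w := by
      intro y
      rw [← hrow (0 + u) (y + v), ← hper]
    refine IsStacking.not_periodic v.natAbs (by omega) 0 _ _ hlevel hstack fun y => ?_
    rcases Int.natAbs_eq v with h | h
    · rw [← h, hsv]
    · rw [← hsv, show y + v.natAbs + v = y by omega]

/-! ### Existence of a tiling by expansion and compactness -/

/-- `b` is reached from `a` in `k` steps of the relation `R`. -/
def Reach {α : Type} (R : α → α → Prop) (k : ℕ) (a b : α) : Prop :=
  ∃ W : ℕ → α, W 0 = a ∧ W k = b ∧ ∀ i < k, R (W i) (W (i + 1))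

theorem Reach.single {α : Type} {R : α → α → Prop} {a b : α} (h : R a b) : Reach R 1 a b :=
  ⟨fun i => if i = 0 then a else b, rfl, rfl, fun i hi => by
    obtain rfl : i = 0 := by omega
    exact h⟩

theorem Reach.trans {α : Type} {R : α → α → Prop} {a b d : α} {k l : ℕ} (h : Reach R k a b)
    (h' : Reach R l b d) : Reach R (k + l) a d := by
  obtain ⟨W, h0, hk, hW⟩ := h
  obtain ⟨W', h0', hl, hW'⟩ := h'
  refine ⟨fun i => if i < k then W i else W' (i - k), ?_, ?_, fun i hi => ?_⟩
  · by_cases h : 0 < k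
    · simp [h, h0]
    · obtain rfl : k = 0 := by omega
      simp [h0', ← hk, h0]
  · simp [hl]
  · dsimp only
    by_cases h : i + 1 < k
    · rw [if_pos (by omega), if_pos h]
      exact hW i (by omega)
    · rw [if_neg h]
      by_cases h1 : i < k
      · obtain rfl : i + 1 = k := by omega
        rw [if_pos h1, Nat.sub_self, h0', ← hk]
        exact hW i h1
      · rw [if_neg h1, Nat.sub_add_comm (by omega)]
        exact hW' (i - k) (by omega)

/-- A row of `T_n` expands into many rows of `T_0 ∪ T_1 ∪ T_2`. -/
theorem reach_of_rel (n : ℕ) : ∀ w w', (transT n).Rel w w' →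
    ∃ k, 0 < k ∧ n ≤ 2 * k ∧ Reach unionT.Rel k w w' := by
  induction n using Nat.strong_induction_on with
  | _ n ih =>
    intro w w' h
    match n with
    | 0 => exact ⟨1, by omega, by omega, .single (union_rel_left (union_rel_left h))⟩
    | 1 => exact ⟨1, by omega, by omega, .single (union_rel_left (union_rel_right h))⟩
    | 2 => exact ⟨1, by omega, by omega, .single (union_rel_right h)⟩
    | n + 3 =>
      obtain ⟨w₁, w₂, h₀, h₁, h₂⟩ := transT_rel_split h
      obtain ⟨k₀, p₀, q₀, r₀⟩ := ih (n + 1) (by omega) _ _ h₀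
      obtain ⟨k₁, p₁, q₁, r₁⟩ := ih n (by omega) _ _ h₁
      obtain ⟨k₂, p₂, q₂, r₂⟩ := ih (n + 1) (by omega) _ _ h₂
      exact ⟨k₀ + k₁ + k₂, by omega, by omega, (r₀.trans r₁).trans r₂⟩

theorem Tile.finite (H V : Type) [Finite H] [Finite V] : Finite (Tile H V) :=
  Finite.of_injective (β := H × H × V × V) (fun t => (t.w, t.e, t.s, t.n)) fun a b h => by
    cases a
    cases b
    simpa using h

/-- A Wang set that tiles arbitrarily high strips tiles the plane. -/
theorem WangSet.exists_isTiling {V : Type} (A : WangSet V)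
    (h : ∀ N : ℕ, ∃ w : ℕ → ℤ → V, ∀ i < N, A.Rel (w i) (w (i + 1))) :
    ∃ f : ℤ → ℤ → Tile A.State V, A.IsTiling f := by
  have := A.finite_state
  have := A.finite_color
  have := Tile.finite A.State V
  let : TopologicalSpace (Tile A.State V) := ⊥
  have : DiscreteTopology (Tile A.State V) := ⟨rfl⟩
  let ok : Tile A.State V × Tile A.State V × Tile A.State V → Prop :=
    fun t => t.1 ∈ A.tiles ∧ t.1.e = t.2.1.w ∧ t.1.n = t.2.2.s
  -- Only a strip is constrained, so each `F N` is nonempty by hypothesis; these closed sets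
  -- decrease in a compact product of finite discrete spaces.
  let F : ℕ → Set (ℤ → ℤ → Tile A.State V) := fun N =>
    {f | ∀ y : ℤ, -N ≤ y → y < N → ∀ x, ok (f x y, f (x + 1) y, f x (y + 1))}
  have hclosed : ∀ N, IsClosed (F N) := by
    intro N
    have e : F N = ⋂ y : ℤ, ⋂ _ : -N ≤ y, ⋂ _ : y < N, ⋂ x : ℤ,
        (fun f : ℤ → ℤ → Tile A.State V => (f x y, f (x + 1) y, f x (y + 1))) ⁻¹' {t | ok t} := by
      ext f
      simp [F]
    rw [e]
    refine isClosed_iInter fun y => isClosed_iInter fun _ => isClosed_iInter fun _ =>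
      isClosed_iInter fun x => (isClosed_discrete _).preimage ?_
    fun_prop
  have hne : ∀ N, (F N).Nonempty := by
    intro N
    -- Rows -N to N are needed, since the condition at row N - 1 involves row N.
    obtain ⟨w, hw⟩ := h (2 * N + 1)
    have : Nonempty (ℤ → Tile A.State V) := ⟨(hw 0 (by omega)).choose⟩
    choose! g h1 h2 h3 h4 using hw
    refine ⟨fun x y => g (y + N).toNat x, fun y hy hy' x => ⟨h1 _ (by omega) x,
      h2 _ (by omega) x, ?_⟩⟩
    dsimp only
    rw [show (y + 1 + N).toNat = (y + N).toNat + 1 by omega, h4 _ (by omega), h3 _ (by omega)]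
  obtain ⟨f, hf⟩ := IsCompact.nonempty_iInter_of_sequence_nonempty_isCompact_isClosed F
    (fun N f hf y h1 h2 => hf y (by push_cast; omega) (by push_cast; omega)) hne
    (hclosed 0).isCompact hclosed
  rw [Set.mem_iInter] at hf
  have key : ∀ x y, ok (f x y, f (x + 1) y, f x (y + 1)) := fun x y =>
    hf (y.natAbs + 1) y (by omega) (by omega) x
  exact ⟨f, fun x y => (key x y).1, fun x y => (key x y).2.1, fun x y => (key x y).2.2⟩

theorem unionT_exists_isTiling : ∃ f, unionT.IsTiling f := by
  refine WangSet.exists_isTiling _ fun N => ?_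
  obtain ⟨w, w', h⟩ := exists_transT_rel (2 * N)
  obtain ⟨k, -, hk, W, -, -, hW⟩ := reach_of_rel _ _ _ h
  exact ⟨W, fun i hi => hW i (by omega)⟩

theorem mainTheorem7 :
    (∀ (n : ℕ) (s : ℤ → ℕ) (w : ℤ → ℤ → Fin 2),
      (∀ i, s i = n ∨ s i = n + 1 ∨ s i = n + 2) →
      IsStacking s w →
      ∃ (c : ℤ → ℤ) (s' : ℤ → ℕ),
        IsBlockReplacement n s c s' ∧
        (∀ j, s' j = n + 1 ∨ s' j = n + 2 ∨ s' j = n + 3) ∧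
        IsStacking s' (fun j => w (c j))) ∧
    (∀ f, (((transT 0).union (transT 1)).union (transT 2)).IsTiling f →
      ¬ WangSet.IsPeriodicTiling f) ∧
    (((transT 0).union (transT 1)).union (transT 2)).IsAperiodic := by
  refine ⟨fun n s w hs hw => ?_, unionT_not_periodic, unionT_exists_isTiling, unionT_not_periodic⟩
  obtain ⟨c, s', -, hC, step, hs', hw'⟩ := hw.exists_replacement hs
  refine ⟨c, s', ⟨fun j => ?_, fun i hi => ?_⟩, fun j => ?_, hw'⟩
  · rcases step j with ⟨h1, h2, -⟩ | ⟨h1, h2, h3⟩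
    · exact .inl ⟨h1, h2⟩
    · exact .inr ⟨h1, h2, (hw.blockAt_iff hs _).2 h3⟩
  · obtain ⟨j, rfl⟩ := (hC i).1 ⟨by have := hi.1; omega, fun h => by
      refine hw.isolated hs h ?_
      convert hi.2.1 using 2
      ring⟩
    refine ⟨j, rfl, ?_⟩
    rcases step j with ⟨-, -, h⟩ | ⟨h, -⟩
    · exact (h hi.2.1).elim
    · exact h
  · have := hs' j
    omega
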